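/- Let $n\ge 3$. Identify the Stiefel manifold $V_2\mathbb{R}^n=\mathrm{SO}(n)/\mathrm{SO}(n-2)$ with the set of orthonormal $2$-frames in $\mathbb{R}^n$, with origin $o=(e_1,e_2)$ and $\mathrm{SO}(n-2)$ embedded in the lower right corner of $\mathrm{SO}(n)$. Let $B(X,Y)=-(n-2)\,\mathrm{tr}(XY)$ be the negative of the Killing form of $\mathfrak{so}(n)$, let $\mathfrak m=\mathfrak{so}(n-2)^{\perp}\subset\mathfrak{so}(n)$ with respect to $B$, and let $\xi_{ab}=E_{ab}-E_{ba}$. Then $\mathfrak m=\mathfrak m_{12}\oplus\mathfrak m_{13}\oplus\mathfrak m_{23}$ with $\mathfrak m_{12}=\mathrm{span}\{\xi_{12}\}$, $\mathfrak m_{13}=\mathrm{span}\{\xi_{13},\dots,\xi_{1n}\}$, $\mathfrak m_{23}=\mathrm{span}\{\xi_{23},\dots,\xi_{2n}\}$. Consider the $\mathrm{SO}(n)$-invariant Riemannian metrics on $V_2\mathbb{R}^n$ given on $\mathfrak m\cong T_o(V_2\mathbb{R}^n)$ by $\langle X,Y\rangle=B(\Lambda X,Y)$ with $\Lambda=\lambda_{12}\mathrm{Id}_{\mathfrak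 m_{12}}+\lambda_{13}\mathrm{Id}_{\mathfrak m_{13}}+\lambda_{23}\mathrm{Id}_{\mathfrak m_{23}}$, where $\lambda_{12},\lambda_{13},\lambda_{23}>0$. A nonzero $X\in\mathfrak m$ is called an equigeodesic vector if the curve $\gamma(t)=\exp(tX)\cdot o$ is a geodesic with respect to every metric of this three-parameter family; a vector is called trivial if it lies in one of $\mathfrak m_{12},\mathfrak m_{13},\mathfrak m_{23}$. (1) Let $X=a_{12}\xi_{12}+\sum_{k=3}^n a_{1k}\xi_{1k}+\sum_{k=3}^n a_{2k}\xi_{2k}$ be a nonzero vector of $\mathfrak m$. Then $X$ is an equigeodesic vector if and only if $a_{12}a_{1k}=a_{12}a_{2k}=0$ for all $3\le k\le n$ and $\sum_{k=3}^n a_{1k}a_{2k}=0$. (2) The equigeodesic vectors are exactly the nonzero elements of the union of the following $n$ classes $C_1,\dots,C_n$: $C_1=\mathrm{span}\{\xi_{12}\}$; $C_2=\mathrm{span}\{\xi_{23},\dots,\xi_{2n}\}$; $C_3$ is the set of the vectors $a_{13}\xi_{13}+a_{24}\xi_{24}+\dots+a_{2n}\xi_{2n}$; and, for $4\le k\le n$,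 $C_k$ is the set of the vectors $$\sum_{j=3}^{k}a_{1j}\xi_{1j}+\sum_{j=3}^{k-1}a_{2j}\xi_{2j}-\frac{\sum_{j=3}^{k-1}a_{1j}a_{2j}}{a_{1k}}\,\xi_{2k}+\sum_{j=k+1}^{n}a_{2j}\xi_{2j},\qquad a_{1k}\ne 0.$$ None of these $n$ classes is contained in the union of the others: each has a nonzero element that lies in no other class. (3) The classes $C_1=\mathfrak m_{12}$ and $C_2=\mathfrak m_{23}$ are trivial, that is, they consist of trivial vectors. If $n\ge 4$, they are the only trivial classes: each of $C_3,\dots,C_n$ contains a nontrivial vector. -/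

import Mathlib

open scoped Matrix ContDiff

noncomputable section

namespace Stiefel

/-! ### The Lie algebra of `SO(n)` and the reductive decomposition

Rows and columns of matrices are indexed by `Fin n`; the labels `a, b` of the basis matrices
`ξ_ab` are natural numbers that run from `1` to `n`. -/

/-- The matrix unit `E_ab`, with `1 ≤ a, b ≤ n`. -/
def matUnit (n a b : ℕ) : Matrix (Fin n) (Fin n) ℝ :=
  Matrix.of fun i j => if i.val + 1 = a ∧ j.val + 1 = b then 1 else 0

/-- `ξ_ab = E_ab - E_ba`. -/
def xi (n a b : ℕ) : Matrix (Fin n) (Fin n) ℝ := matUnit n a b - matUnit n b a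

/-- The negative `B(X, Y) = -(n - 2) tr(XY)` of the Killing form of `so(n)`. -/
def negKilling (n : ℕ) (X Y : Matrix (Fin n) (Fin n) ℝ) : ℝ :=
  -((n : ℝ) - 2) * (X * Y).trace

/-- `X` belongs to the Lie algebra `so(n-2)` of the subgroup `SO(n-2)` that sits in the lower right
corner of `SO(n)`: it is skew-symmetric and its first two rows (hence columns) vanish. -/
def IsotropyAlg (n : ℕ) (X : Matrix (Fin n) (Fin n) ℝ) : Prop :=
  X ∈ LieAlgebra.Orthogonal.so (Fin n) ℝ ∧ ∀ i j : Fin n, i.val < 2 → X i j = 0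

/-- The `B`-orthogonal complement `𝔪` of `so(n-2)` in `so(n)`. -/
def TangentAlg (n : ℕ) : Set (Matrix (Fin n) (Fin n) ℝ) :=
  {X | X ∈ LieAlgebra.Orthogonal.so (Fin n) ℝ ∧ ∀ Y, IsotropyAlg n Y → negKilling n X Y = 0}

/-- `𝔪₁₂ = span {ξ₁₂}`. -/
def m12 (n : ℕ) : Submodule ℝ (Matrix (Fin n) (Fin n) ℝ) := Submodule.span ℝ {xi n 1 2}

/-- `𝔪₁₃ = span {ξ₁₃, …, ξ₁ₙ}`. -/
def m13 (n : ℕ) : Submodule ℝ (Matrix (Fin n) (Fin n) ℝ) :=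
  Submodule.span ℝ {X | ∃ k ∈ Finset.Icc 3 n, X = xi n 1 k}

/-- `𝔪₂₃ = span {ξ₂₃, …, ξ₂ₙ}`. -/
def m23 (n : ℕ) : Submodule ℝ (Matrix (Fin n) (Fin n) ℝ) :=
  Submodule.span ℝ {X | ∃ k ∈ Finset.Icc 3 n, X = xi n 2 k}

/-- The vector `a₁₂ ξ₁₂ + ∑ₖ a₁ₖ ξ₁ₖ + ∑ₖ a₂ₖ ξ₂ₖ`, where `k = 3, …, n`. -/
def tangentVec (n : ℕ) (a : ℕ → ℕ → ℝ) : Matrix (Fin n) (Fin n) ℝ :=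
  a 1 2 • xi n 1 2 + ∑ k ∈ Finset.Icc 3 n, a 1 k • xi n 1 k
    + ∑ k ∈ Finset.Icc 3 n, a 2 k • xi n 2 k

/-! ### The Stiefel manifold as a homogeneous space -/

/-- `V₂ℝⁿ`: the orthonormal 2-frames in `ℝⁿ`, each written as an `n × 2` matrix with orthonormal
columns. The group `SO(n)` acts by multiplication from the left. -/
def Frames (n : ℕ) : Set (Matrix (Fin n) (Fin 2) ℝ) := {F | Fᵀ * F = 1}

/-- The origin `o = (e₁, e₂)`; its stabilizer is `SO(n-2)`, embedded in the lower right corner. -/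
def origin (n : ℕ) : Matrix (Fin n) (Fin 2) ℝ :=
  Matrix.of fun i j => if i.val = j.val then 1 else 0

/-- The tangent space of `V₂ℝⁿ` at the frame `F`. -/
def tangentAt (n : ℕ) (F : Matrix (Fin n) (Fin 2) ℝ) : Set (Matrix (Fin n) (Fin 2) ℝ) :=
  {v | Fᵀ * v + vᵀ * F = 0}

/-- An `SO(n)`-invariant Riemannian metric on `V₂ℝⁿ`. Only the values of `inner F` on tangent
vectors at frames `F` matter, and only these are constrained. Smooth dependence on `F` follows from
the invariance, since `SO(n)` acts smoothly and transitively. -/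
structure InvariantMetric (n : ℕ) where
  inner : Matrix (Fin n) (Fin 2) ℝ → LinearMap.BilinForm ℝ (Matrix (Fin n) (Fin 2) ℝ)
  symm : ∀ F ∈ Frames n, ∀ v ∈ tangentAt n F, ∀ w ∈ tangentAt n F, inner F v w = inner F w v
  pos : ∀ F ∈ Frames n, ∀ v ∈ tangentAt n F, v ≠ 0 → 0 < inner F v v
  invariant : ∀ R ∈ Matrix.specialOrthogonalGroup (Fin n) ℝ, ∀ F ∈ Frames n,
    ∀ v ∈ tangentAt n F, ∀ w ∈ tangentAt n F, inner (R * F) (R * v) (R * w) = inner F v w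

/-- The metric corresponds, under the identification `X ↦ X * o` of `𝔪` with the tangent space at
the origin, to `⟨X, Y⟩ = B(Λ X, Y)` with `Λ = l₁₂ Id + l₁₃ Id + l₂₃ Id` on `𝔪₁₂ ⊕ 𝔪₁₃ ⊕ 𝔪₂₃`. -/
def InvariantMetric.HasOperator {n : ℕ} (g : InvariantMetric n) (l12 l13 l23 : ℝ) : Prop :=
  ∀ X12 ∈ m12 n, ∀ X13 ∈ m13 n, ∀ X23 ∈ m23 n, ∀ Y ∈ TangentAlg n,
    g.inner (origin n) ((X12 + X13 + X23) * origin n) (Y * origin n)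
      = negKilling n (l12 • X12 + l13 • X13 + l23 • X23) Y

/-- The three-parameter family of invariant metrics `Λ = (l₁₂, l₁₃, l₂₃)` with positive entries. -/
def InvariantMetric.IsDiagonal {n : ℕ} (g : InvariantMetric n) : Prop :=
  ∃ l12 l13 l23 : ℝ, 0 < l12 ∧ 0 < l13 ∧ 0 < l23 ∧ g.HasOperator l12 l13 l23

/-! ### Geodesics -/

/-- The velocity of a curve of `n × 2` matrices. -/
def velocity {n : ℕ} (γ : ℝ → Matrix (Fin n) (Fin 2) ℝ) (t : ℝ) : Matrix (Fin n) (Fin 2) ℝ :=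
  Matrix.of fun i j => deriv (fun u => γ u i j) t

/-- The energy of the curve `γ` between the times `a` and `b`. -/
def InvariantMetric.energy {n : ℕ} (g : InvariantMetric n) (a b : ℝ)
    (γ : ℝ → Matrix (Fin n) (Fin 2) ℝ) : ℝ :=
  (1 / 2) * ∫ t in a..b, g.inner (γ t) (velocity γ t) (velocity γ t)

/-- `Γ s t` is a smooth variation of the curve `γ` within `V₂ℝⁿ`, with fixed end points at the
times `a` and `b`. -/
structure IsProperVariation {n : ℕ} (γ : ℝ → Matrix (Fin n) (Fin 2) ℝ) (a b : ℝ)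
    (Γ : ℝ → ℝ → Matrix (Fin n) (Fin 2) ℝ) : Prop where
  smooth : ∀ i j, ContDiff ℝ ∞ fun p : ℝ × ℝ => Γ p.1 p.2 i j
  mem : ∀ s t, Γ s t ∈ Frames n
  base : ∀ t, Γ 0 t = γ t
  left : ∀ s, Γ s a = γ a
  right : ∀ s, Γ s b = γ b

/-- A smooth curve in `V₂ℝⁿ` is a geodesic of `g` if, on each compact interval, it is a critical
point of the energy among the curves with the same end points. -/
def InvariantMetric.IsGeodesic {n : ℕ} (g : InvariantMetric n)
    (γ : ℝ → Matrix (Fin n) (Fin 2) ℝ) : Prop :=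
  (∀ i j, ContDiff ℝ ∞ fun t => γ t i j) ∧ (∀ t, γ t ∈ Frames n) ∧
    ∀ a b : ℝ, a < b → ∀ Γ : ℝ → ℝ → Matrix (Fin n) (Fin 2) ℝ, IsProperVariation γ a b Γ →
      HasDerivAt (fun s => g.energy a b (Γ s)) 0 0

/-! ### Equigeodesic vectors -/

/-- The homogeneous curve `γ(t) = exp(tX) · o`. -/
def orbitCurve {n : ℕ} (X : Matrix (Fin n) (Fin n) ℝ) (t : ℝ) : Matrix (Fin n) (Fin 2) ℝ :=
  NormedSpace.exp (t • X) * origin n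

/-- A nonzero `X ∈ 𝔪` is an equigeodesic vector if `exp(tX) · o` is a geodesic with respect to
every invariant metric `Λ = (l₁₂, l₁₃, l₂₃)`. -/
def IsEquigeodesicVector (n : ℕ) (X : Matrix (Fin n) (Fin n) ℝ) : Prop :=
  X ∈ TangentAlg n ∧ X ≠ 0 ∧ ∀ g : InvariantMetric n, g.IsDiagonal → g.IsGeodesic (orbitCurve X)

/-- A vector is trivial if it lies in one of the three modules. -/
def IsTrivialVector (n : ℕ) (X : Matrix (Fin n) (Fin n) ℝ) : Prop :=
  X ∈ m12 n ∨ X ∈ m13 n ∨ X ∈ m23 n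

/-- The explicit classes of vectors, numbered from `1` to `n`:
class `1` is `span {ξ₁₂}`; class `2` is `span {ξ₂₃, …, ξ₂ₙ}`; class `3` consists of the vectors
`a₁₃ ξ₁₃ + a₂₄ ξ₂₄ + ⋯ + a₂ₙ ξ₂ₙ`; class `k`, for `4 ≤ k ≤ n`, consists of the vectors
`a₁₃ ξ₁₃ + ⋯ + a₁ₖ ξ₁ₖ + a₂₃ ξ₂₃ + ⋯ + a₂ₙ ξ₂ₙ` with `a₁ₖ ≠ 0` and
`a₂ₖ = -(a₁₃ a₂₃ + ⋯ + a₁,ₖ₋₁ a₂,ₖ₋₁) / a₁ₖ`. -/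
def vectorClass (n : ℕ) : ℕ → Set (Matrix (Fin n) (Fin n) ℝ)
  | 0 => ∅
  | 1 => Submodule.span ℝ {xi n 1 2}
  | 2 => Submodule.span ℝ {X | ∃ k ∈ Finset.Icc 3 n, X = xi n 2 k}
  | 3 => {X | ∃ a : ℕ → ℕ → ℝ,
      X = a 1 3 • xi n 1 3 + ∑ j ∈ Finset.Icc 4 n, a 2 j • xi n 2 j}
  | k => {X | ∃ a : ℕ → ℕ → ℝ, a 1 k ≠ 0 ∧
      X = ∑ j ∈ Finset.Icc 3 k, a 1 j • xi n 1 j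
        + ∑ j ∈ Finset.Ico 3 k, a 2 j • xi n 2 j
        - ((∑ j ∈ Finset.Ico 3 k, a 1 j * a 2 j) / a 1 k) • xi n 2 k
        + ∑ j ∈ Finset.Icc (k + 1) n, a 2 j • xi n 2 j}

end Stiefel

end

/-! A frame is a pair of columns (u, v). An invariant metric with operator Λ is forced to be
`diagForm`, that is, 2(n - 2) times (l₁₂ - l₁₃ - l₂₃)⟨v, u'⟩² + l₁₃|u'|² + l₂₃|v'|² on a velocity
(u', v'): the two agree at the origin (`negKilling_eq_diagForm`), both are invariant, and `SO(n)` is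
transitive on frames (`InvariantMetric.HasOperator.inner_eq`).

Along exp(tX) · o the product ⟨v, u'⟩ is constant, so the first variation of the energy is the
integral of the variation field against exp(tX) times the fixed matrix `eulerMat`
(`hasDerivAt_energy`). The orthogonal factor exp(tX) cancels, and the geodesic equation becomes a
linear condition on all Y in 𝔪 (`energy_criterion`). For Y with coordinates b it reads (l₂₃ - l₁₃)
b₁₂ ∑ a₁ₖa₂ₖ + ∑ ((l₁₂ - l₂₃) b₁ₖ a₁₂a₂ₖ + (l₁₃ - l₁₂) b₂ₖ a₁₂a₁ₖ) = 0 (`eulerMat_trace`). A single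
metric with pairwise distinct parameters already forces every product to vanish, and once they
vanish the condition holds for all parameters.

The classes solve this system. If a₁₂ ≠ 0, everything else is zero. If a₁₂ = 0, let k be the largest
label with a₁ₖ ≠ 0: when there is none the vector lies in 𝔪₂₃, and otherwise the orthogonality
relation is solved for a₂ₖ. The vectors ξ₁₂, ξ₂₃ and ξ₁ₖ separate the classes; ξ₁ₖ + ξ₂ₗ with l ≠ k
is nontrivial. -/

namespace Stiefel

open Matrix

variable {n : ℕ}

/-! ### Entries of the basic matrices -/

/-- The first index. -/
def i0 (hn : 3 ≤ n) : Fin n := ⟨0, by omega⟩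

/-- The second index. -/
def i1 (hn : 3 ≤ n) : Fin n := ⟨1, by omega⟩

theorem xi_apply (a b : ℕ) (i j : Fin n) :
    xi n a b i j = (if i.val + 1 = a ∧ j.val + 1 = b then 1 else 0)
      - (if i.val + 1 = b ∧ j.val + 1 = a then 1 else 0) := rfl

theorem matUnit_eq_single (i j : Fin n) :
    matUnit n (i.val + 1) (j.val + 1) = single i j 1 := by
  ext p q
  simp [matUnit, single_apply, Fin.ext_iff, eq_comm]

theorem xi_eq_single (i j : Fin n) :
    xi n (i.val + 1) (j.val + 1) = single i j 1 - single j i 1 := by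
  simp only [xi, matUnit_eq_single]

theorem sum_smul_xi_apply (s : Finset ℕ) (c : ℕ → ℝ) (b : ℕ) (i j : Fin n) :
    (∑ k ∈ s, c k • xi n b k) i j
      = (if i.val + 1 = b ∧ j.val + 1 ∈ s then c (j.val + 1) else 0)
        - (if j.val + 1 = b ∧ i.val + 1 ∈ s then c (i.val + 1) else 0) := by
  simp only [Matrix.sum_apply, Matrix.smul_apply, xi_apply, smul_eq_mul, mul_sub, mul_ite, mul_one,
    mul_zero, Finset.sum_sub_distrib]
  congr 1
  · by_cases h : i.val + 1 = b <;> simp [h]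
  · by_cases h : j.val + 1 = b <;> simp [h]

theorem tangentVec_apply (a : ℕ → ℕ → ℝ) (i j : Fin n) :
    tangentVec n a i j =
      if i.val = 0 then (if j.val = 0 then 0 else a 1 (j.val + 1))
      else if i.val = 1 then
        (if j.val = 0 then -a 1 2 else if j.val = 1 then 0 else a 2 (j.val + 1))
      else if j.val = 0 then -a 1 (i.val + 1)
      else if j.val = 1 then -a 2 (i.val + 1) else 0 := by
  obtain ⟨i, hi⟩ := i
  obtain ⟨j, hj⟩ := j
  simp only [tangentVec, Matrix.add_apply, Matrix.smul_apply, xi_apply, sum_smul_xi_apply,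
    Finset.mem_Icc, smul_eq_mul]
  rcases i with _ | _ | i <;> rcases j with _ | _ | j <;> simp <;> intros <;> omega

/-! ### Skew-symmetric matrices, the form B and coordinates on 𝔪 -/

theorem mem_so_iff {X : Matrix (Fin n) (Fin n) ℝ} :
    X ∈ LieAlgebra.Orthogonal.so (Fin n) ℝ ↔ ∀ i j, X i j = -X j i := by
  rw [LieAlgebra.Orthogonal.mem_so]
  constructor
  · intro h i j
    simpa using congrFun (congrFun h j) i
  · intro h
    ext i j
    simpa using h j i

/-- The two matrix units contribute Y j i - Y i j = -2 Y i j to the trace. The resulting factor 2(n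
- 2) is the normalisation of `diagForm`. -/
theorem negKilling_xi (i j : Fin n) {Y : Matrix (Fin n) (Fin n) ℝ} (hY : ∀ i j, Y i j = -Y j i) :
    negKilling n (xi n (i.val + 1) (j.val + 1)) Y = 2 * ((n : ℝ) - 2) * Y i j := by
  rw [negKilling, xi_eq_single, Matrix.sub_mul, trace_sub, trace_single_mul, trace_single_mul]
  simp only [smul_eq_mul, one_mul]
  rw [hY j i]
  ring

theorem negKilling_add_left (X X' Y : Matrix (Fin n) (Fin n) ℝ) :
    negKilling n (X + X') Y = negKilling n X Y + negKilling n X' Y := by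
  simp only [negKilling, Matrix.add_mul, trace_add]
  ring

theorem negKilling_smul_left (c : ℝ) (X Y : Matrix (Fin n) (Fin n) ℝ) :
    negKilling n (c • X) Y = c * negKilling n X Y := by
  simp only [negKilling, Matrix.smul_mul, trace_smul, smul_eq_mul]
  ring

theorem negKilling_comm (X Y : Matrix (Fin n) (Fin n) ℝ) :
    negKilling n X Y = negKilling n Y X := by
  simp only [negKilling, trace_mul_comm X Y]

/-- Pairing with the ξ_ab of the lower right block reads off the entries of X there, up to the
factor 2(n - 2), nonzero for n ≥ 3. Conversely, every term of the trace has a factor outside the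
block of Y or inside that of X. -/
theorem mem_TangentAlg_iff_entries (hn : 3 ≤ n) {X : Matrix (Fin n) (Fin n) ℝ} :
    X ∈ TangentAlg n ↔ (∀ i j, X i j = -X j i) ∧
      ∀ i j : Fin n, 2 ≤ i.val → 2 ≤ j.val → X i j = 0 := by
  have hn2 : (0 : ℝ) < (n : ℝ) - 2 := by
    have : (3 : ℝ) ≤ n := by exact_mod_cast hn
    linarith
  simp only [TangentAlg, Set.mem_ofPred_eq, mem_so_iff]
  refine and_congr_right fun hX => ⟨fun h i j hi hj => ?_, fun h Y hY => ?_⟩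
  · have := h (xi n (i.val + 1) (j.val + 1)) ⟨mem_so_iff.2 fun p q => ?_, fun p q hp => ?_⟩
    · rw [negKilling_comm, negKilling_xi _ _ hX] at this
      have h2 : 2 * ((n : ℝ) - 2) ≠ 0 := by positivity
      exact (mul_eq_zero.1 this).resolve_left h2
    · simp only [xi_apply, and_comm]
      ring
    · rw [xi_apply, if_neg (by omega), if_neg (by omega), sub_zero]
  · obtain ⟨hY, hY0⟩ := hY
    rw [mem_so_iff] at hY
    rw [negKilling, trace]
    refine mul_eq_zero_of_right _ (Finset.sum_eq_zero fun i _ => ?_)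
    rw [diag_apply, mul_apply]
    refine Finset.sum_eq_zero fun j _ => ?_
    rcases lt_or_ge j.val 2 with hj | hj
    · rw [hY0 j i hj, mul_zero]
    · rcases lt_or_ge i.val 2 with hi | hi
      · rw [hY j i, hY0 i j hi, neg_zero, mul_zero]
      · rw [h i j hi hj, zero_mul]

theorem tangentVec_mem_TangentAlg (hn : 3 ≤ n) (a : ℕ → ℕ → ℝ) :
    tangentVec n a ∈ TangentAlg n := by
  refine (mem_TangentAlg_iff_entries hn).2 ⟨fun i j => ?_, fun i j hi hj => ?_⟩
  · rw [tangentVec_apply, tangentVec_apply]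
    obtain ⟨i, hi⟩ := i
    obtain ⟨j, hj⟩ := j
    rcases i with _ | _ | i <;> rcases j with _ | _ | j <;> simp
  · rw [tangentVec_apply, if_neg (by omega), if_neg (by omega), if_neg (by omega),
      if_neg (by omega)]

/-- The coordinate function of a matrix: entries with labels starting from `1`. -/
def coords (n : ℕ) (X : Matrix (Fin n) (Fin n) ℝ) (p q : ℕ) : ℝ :=
  -- Truncated subtraction lets label 0 read the first row or column; only labels from 1 to n are
  -- ever used.
  if h : p - 1 < n ∧ q - 1 < n then X ⟨p - 1, h.1⟩ ⟨q - 1, h.2⟩ else 0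

theorem coords_succ (X : Matrix (Fin n) (Fin n) ℝ) (i j : Fin n) :
    coords n X (i.val + 1) (j.val + 1) = X i j := by
  simp [coords]

theorem tangentVec_coords (hn : 3 ≤ n) {X : Matrix (Fin n) (Fin n) ℝ} (hX : X ∈ TangentAlg n) :
    tangentVec n (coords n X) = X := by
  rw [mem_TangentAlg_iff_entries hn] at hX
  obtain ⟨hX, h0⟩ := hX
  have hd : ∀ i, X i i = 0 := fun i => by linarith [hX i i]
  have c1 : ∀ j : Fin n, coords n X 1 (j.val + 1) = X (i0 hn) j := fun j => coords_succ X (i0 hn) j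
  have c2 : ∀ j : Fin n, coords n X 2 (j.val + 1) = X (i1 hn) j := fun j => coords_succ X (i1 hn) j
  have c12 : coords n X 1 2 = X (i0 hn) (i1 hn) := c1 (i1 hn)
  ext i j
  rw [tangentVec_apply, c1, c1, c2, c2, c12]
  have e0 : ∀ i : Fin n, i.val = 0 → i = i0 hn := fun i h => Fin.ext h
  have e1 : ∀ i : Fin n, i.val = 1 → i = i1 hn := fun i h => Fin.ext h
  split_ifs with h1 h2 h2 h3 h4 h3 h4
  · rw [e0 i h1, e0 j h2, hd]
  · rw [e0 i h1]
  · rw [e1 i h2, e0 j h3, hX (i1 hn)]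
  · rw [e1 i h2, e1 j h4, hd]
  · rw [e1 i h2]
  · rw [e0 j h3, hX i]
  · rw [e1 j h4, hX i]
  · rw [h0 i j (by omega) (by omega)]

theorem mem_TangentAlg_iff (hn : 3 ≤ n) (X : Matrix (Fin n) (Fin n) ℝ) :
    X ∈ TangentAlg n ↔ ∃ a : ℕ → ℕ → ℝ, X = tangentVec n a :=
  ⟨fun h => ⟨_, (tangentVec_coords hn h).symm⟩, fun ⟨a, h⟩ => h ▸ tangentVec_mem_TangentAlg hn a⟩

/-- Two tangent vectors agree if and only if their coordinates do. -/
theorem tangentVec_inj (hn : 3 ≤ n) {a b : ℕ → ℕ → ℝ} :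
    tangentVec n a = tangentVec n b ↔
      a 1 2 = b 1 2 ∧ ∀ k ∈ Finset.Icc 3 n, a 1 k = b 1 k ∧ a 2 k = b 2 k := by
  constructor
  · intro h
    refine ⟨?_, fun k hk => ?_⟩
    · simpa [tangentVec_apply, i0, i1] using congrFun (congrFun h (i0 hn)) (i1 hn)
    · obtain ⟨hk3, hkn⟩ := Finset.mem_Icc.1 hk
      obtain ⟨l, rfl⟩ : ∃ l, k = l + 2 + 1 := ⟨k - 3, by omega⟩
      have h1 := congrFun (congrFun h (i0 hn)) ⟨l + 2, by omega⟩
      have h2 := congrFun (congrFun h (i1 hn)) ⟨l + 2, by omega⟩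
      simp only [tangentVec_apply, i0, i1] at h1 h2
      simpa using And.intro h1 h2
  · rintro ⟨h12, h⟩
    simp only [tangentVec, h12]
    congr 1
    · congr 1
      exact Finset.sum_congr rfl fun k hk => by rw [(h k hk).1]
    · exact Finset.sum_congr rfl fun k hk => by rw [(h k hk).2]

/-! ### Transitivity of `SO(n)` on frames -/

theorem mul_origin_apply_zero (hn : 3 ≤ n) (X : Matrix (Fin n) (Fin n) ℝ) (i : Fin n) :
    (X * origin n) i 0 = X i (i0 hn) := by
  rw [mul_apply, Finset.sum_eq_single (i0 hn)]
  · simp [origin, i0]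
  · intro j _ hj
    have : j.val ≠ 0 := fun h => hj (Fin.ext h)
    simp [origin, this]
  · simp

theorem mul_origin_apply_one (hn : 3 ≤ n) (X : Matrix (Fin n) (Fin n) ℝ) (i : Fin n) :
    (X * origin n) i 1 = X i (i1 hn) := by
  rw [mul_apply, Finset.sum_eq_single (i1 hn)]
  · simp [origin, i1]
  · intro j _ hj
    have : j.val ≠ 1 := fun h => hj (Fin.ext h)
    simp [origin, this]
  · simp

theorem origin_apply (i : Fin n) (j : Fin 2) :
    origin n i j = if i.val = j.val then 1 else 0 := rfl

theorem origin_transpose_mul_apply_zero (hn : 3 ≤ n) (v : Matrix (Fin n) (Fin 2) ℝ) (j : Fin 2) :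
    ((origin n)ᵀ * v) 0 j = v (i0 hn) j := by
  rw [mul_apply, Finset.sum_eq_single (i0 hn)]
  · simp [origin, i0]
  · intro k _ hk
    have : k.val ≠ 0 := fun h => hk (Fin.ext h)
    simp [origin, this]
  · simp

theorem origin_transpose_mul_apply_one (hn : 3 ≤ n) (v : Matrix (Fin n) (Fin 2) ℝ) (j : Fin 2) :
    ((origin n)ᵀ * v) 1 j = v (i1 hn) j := by
  rw [mul_apply, Finset.sum_eq_single (i1 hn)]
  · simp [origin, i1]
  · intro k _ hk
    have : k.val ≠ 1 := fun h => hk (Fin.ext h)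
    simp [origin, this]
  · simp

theorem origin_mem_Frames (hn : 3 ≤ n) : origin n ∈ Frames n := by
  change (origin n)ᵀ * origin n = 1
  ext i j
  fin_cases i
  · refine (origin_transpose_mul_apply_zero hn _ _).trans ?_
    fin_cases j <;> simp [origin_apply, i0]
  · refine (origin_transpose_mul_apply_one hn _ _).trans ?_
    fin_cases j <;> simp [origin_apply, i1]

theorem mul_mem_Frames {R : Matrix (Fin n) (Fin n) ℝ} (hR : Rᵀ * R = 1)
    {F : Matrix (Fin n) (Fin 2) ℝ} (hF : F ∈ Frames n) : R * F ∈ Frames n := by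
  change (R * F)ᵀ * (R * F) = 1
  rw [transpose_mul, Matrix.mul_assoc, ← Matrix.mul_assoc Rᵀ, hR, Matrix.one_mul]
  exact hF

/-- The two columns of F extend to an orthonormal basis, whose members are the columns of R. -/
theorem exists_orthogonal_mul_origin (hn : 3 ≤ n) {F : Matrix (Fin n) (Fin 2) ℝ}
    (hF : F ∈ Frames n) :
    ∃ R : Matrix (Fin n) (Fin n) ℝ, Rᵀ * R = 1 ∧ R * origin n = F := by
  have hF' : ∀ p q : Fin 2, ∑ r, F r p * F r q = if p = q then 1 else 0 := by
    intro p q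
    have := congrFun (congrFun (show Fᵀ * F = 1 from hF) p) q
    rwa [mul_apply, one_apply] at this
  -- Only the values at `i0` and `i1` matter, since the family is restricted to these indices before
  -- it is extended.
  let c : Fin n → Fin 2 := fun i => if i.val = 0 then 0 else 1
  let v : Fin n → EuclideanSpace ℝ (Fin n) := fun i => WithLp.toLp 2 fun r => F r (c i)
  have hv : Orthonormal ℝ (({i0 hn, i1 hn} : Set (Fin n)).domRestrict v) := by
    rw [orthonormal_iff_ite]
    rintro ⟨p, hp⟩ ⟨q, hq⟩
    have key : inner ℝ (v p) (v q) = if c p = c q then (1 : ℝ) else 0 := by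
      rw [← hF' (c p) (c q)]
      simp [v, PiLp.inner_apply, mul_comm]
    refine key.trans ?_
    have h01 : i0 hn ≠ i1 hn := by simp [i0, i1]
    rcases hp with rfl | rfl <;> rcases hq with rfl | rfl <;> simp [c, i0, i1]
  obtain ⟨b, hb⟩ := hv.exists_orthonormalBasis_extension_of_card_eq (by simp)
  refine ⟨of fun r k => b k r, ?_, ?_⟩
  · ext p q
    have := orthonormal_iff_ite.1 b.orthonormal p q
    rw [PiLp.inner_apply] at this
    rw [mul_apply, one_apply, ← this]
    simp [mul_comm]
  · ext r k
    fin_cases k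
    · refine (mul_origin_apply_zero hn _ _).trans ?_
      have h := congrArg (fun x => x.ofLp r) (hb (i0 hn) (by simp))
      exact h
    · refine (mul_origin_apply_one hn _ _).trans ?_
      have h := congrArg (fun x => x.ofLp r) (hb (i1 hn) (by simp))
      exact h

/-- When the determinant is -1, the third column of R is negated. It exists because n ≥ 3, and the
frame sees only the first two columns. -/
theorem exists_specialOrthogonal_mul_origin (hn : 3 ≤ n) {F : Matrix (Fin n) (Fin 2) ℝ}
    (hF : F ∈ Frames n) :
    ∃ R ∈ Matrix.specialOrthogonalGroup (Fin n) ℝ, R * origin n = F := by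
  obtain ⟨R, hR, hRF⟩ := exists_orthogonal_mul_origin hn hF
  have hdet : R.det * R.det = 1 := by
    simpa using congrArg det hR
  rcases mul_self_eq_one_iff.1 hdet with h | h
  · exact ⟨R, mem_specialOrthogonalGroup_iff.2 ⟨(mem_orthogonalGroup_iff' _ _).2 hR, h⟩, hRF⟩
  · let d : Fin n → ℝ := Function.update 1 ⟨2, by omega⟩ (-1)
    have hdd : ∀ i, d i * d i = 1 := by
      intro i
      by_cases hi : i = ⟨2, by omega⟩
      · simp [d, hi]
      · simp [d, Function.update_of_ne hi]
    refine ⟨R * diagonal d, mem_specialOrthogonalGroup_iff.2 ⟨(mem_orthogonalGroup_iff' _ _).2 ?_, ?_⟩, ?_⟩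
    · rw [transpose_mul,
        Matrix.mul_assoc, ← Matrix.mul_assoc Rᵀ, hR, Matrix.one_mul, diagonal_transpose,
        diagonal_mul_diagonal]
      simp [hdd]
    · rw [det_mul, det_diagonal, h, Finset.prod_update_of_mem (Finset.mem_univ _)]
      simp
    · rw [← hRF]
      ext i k
      fin_cases k
      · refine (mul_origin_apply_zero hn _ _).trans
          (Eq.trans ?_ (mul_origin_apply_zero hn _ _).symm)
        simp [mul_diagonal, d, i0]
      · refine (mul_origin_apply_one hn _ _).trans
          (Eq.trans ?_ (mul_origin_apply_one hn _ _).symm)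
        simp [mul_diagonal, d, i1]

/-! ### The diagonal invariant metrics in closed form -/

/-- The value of the metric with parameters `l₁₂, l₁₃, l₂₃` on tangent vectors `v, w` at `F`. -/
def diagForm (n : ℕ) (l12 l13 l23 : ℝ) (F v w : Matrix (Fin n) (Fin 2) ℝ) : ℝ :=
  -- At the origin the norms of both columns count the 𝔪₁₂ coordinate, with weights l₁₃ and l₂₃; the
  -- first coefficient corrects the total weight to l₁₂.
  2 * ((n : ℝ) - 2) * ((l12 - l13 - l23) * (Fᵀ * v) 1 0 * (Fᵀ * w) 1 0
    + l13 * (vᵀ * w) 0 0 + l23 * (vᵀ * w) 1 1)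

/-- `diagForm` as a bilinear form. -/
def diagBilin (n : ℕ) (l12 l13 l23 : ℝ) (F : Matrix (Fin n) (Fin 2) ℝ) :
    LinearMap.BilinForm ℝ (Matrix (Fin n) (Fin 2) ℝ) :=
  LinearMap.mk₂ ℝ (diagForm n l12 l13 l23 F)
    (fun v v' w => by
      simp only [diagForm, Matrix.mul_add, transpose_add, Matrix.add_mul, Matrix.add_apply]; ring)
    (fun c v w => by
      simp only [diagForm, Matrix.mul_smul, transpose_smul, Matrix.smul_mul, Matrix.smul_apply,
        smul_eq_mul]; ring)
    (fun v w w' => by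
      simp only [diagForm, Matrix.mul_add, Matrix.add_apply]; ring)
    (fun c v w => by
      simp only [diagForm, Matrix.mul_smul, Matrix.smul_apply, smul_eq_mul]; ring)

theorem diagForm_invariant (l12 l13 l23 : ℝ) {R : Matrix (Fin n) (Fin n) ℝ} (hR : Rᵀ * R = 1)
    (F v w : Matrix (Fin n) (Fin 2) ℝ) :
    diagForm n l12 l13 l23 (R * F) (R * v) (R * w) = diagForm n l12 l13 l23 F v w := by
  have h : ∀ A B : Matrix (Fin n) (Fin 2) ℝ, (R * A)ᵀ * (R * B) = Aᵀ * B := by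
    intro A B
    rw [transpose_mul, Matrix.mul_assoc, ← Matrix.mul_assoc Rᵀ, hR, Matrix.one_mul]
  simp only [diagForm, h]

theorem mul_mem_tangentAt {R : Matrix (Fin n) (Fin n) ℝ} (hR : Rᵀ * R = 1)
    {F v : Matrix (Fin n) (Fin 2) ℝ} : R * v ∈ tangentAt n (R * F) ↔ v ∈ tangentAt n F := by
  have h : ∀ A B : Matrix (Fin n) (Fin 2) ℝ, (R * A)ᵀ * (R * B) = Aᵀ * B := by
    intro A B
    rw [transpose_mul, Matrix.mul_assoc, ← Matrix.mul_assoc Rᵀ, hR, Matrix.one_mul]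
  simp only [tangentAt, Set.mem_ofPred_eq, h]

theorem mem_tangentAt_origin_iff (hn : 3 ≤ n) {v : Matrix (Fin n) (Fin 2) ℝ} :
    v ∈ tangentAt n (origin n) ↔
      v (i0 hn) 0 = 0 ∧ v (i1 hn) 1 = 0 ∧ v (i0 hn) 1 = -v (i1 hn) 0 := by
  have hv : ∀ p q, (vᵀ * origin n) p q = ((origin n)ᵀ * v) q p := fun p q => by
    rw [← transpose_apply ((origin n)ᵀ * v), transpose_mul, transpose_transpose]
  simp only [tangentAt, Set.mem_ofPred_eq]
  rw [← Matrix.ext_iff]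
  simp only [Matrix.add_apply, hv, Fin.forall_fin_two, Matrix.zero_apply,
    origin_transpose_mul_apply_zero hn, origin_transpose_mul_apply_one hn]
  constructor
  · rintro ⟨⟨h1, h2⟩, h3, h4⟩
    refine ⟨?_, ?_, ?_⟩ <;> linarith
  · rintro ⟨h1, h2, h3⟩
    refine ⟨⟨?_, ?_⟩, ?_, ?_⟩ <;> linarith

theorem two_mul_sub_pos (hn : 3 ≤ n) : (0 : ℝ) < 2 * ((n : ℝ) - 2) := by
  have : (3 : ℝ) ≤ n := by exact_mod_cast hn
  linarith

/-- The entry s occurs once in each column, up to sign. Splitting it off leaves l₁₂ s² plus l₁₃ and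
l₂₃ times sums of squares of the remaining entries. -/
theorem diagForm_pos_origin (hn : 3 ≤ n) {l12 l13 l23 : ℝ} (h12 : 0 < l12) (h13 : 0 < l13)
    (h23 : 0 < l23) {v : Matrix (Fin n) (Fin 2) ℝ} (hv : v ∈ tangentAt n (origin n))
    (hv0 : v ≠ 0) : 0 < diagForm n l12 l13 l23 (origin n) v v := by
  obtain ⟨h00, h11, h01⟩ := (mem_tangentAt_origin_iff hn).1 hv
  rw [diagForm, origin_transpose_mul_apply_one hn, mul_apply, mul_apply]
  refine mul_pos (two_mul_sub_pos hn) ?_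
  simp only [transpose_apply]
  set s := v (i1 hn) 0
  rw [← Finset.add_sum_erase _ _ (Finset.mem_univ (i1 hn)),
    ← Finset.add_sum_erase (a := i0 hn) _ (fun x => v x 1 * v x 1) (Finset.mem_univ _), h01]
  have hS0 : 0 ≤ ∑ x ∈ Finset.univ.erase (i1 hn), v x 0 * v x 0 :=
    Finset.sum_nonneg fun i _ => mul_self_nonneg _
  have hS1 : 0 ≤ ∑ x ∈ Finset.univ.erase (i0 hn), v x 1 * v x 1 :=
    Finset.sum_nonneg fun i _ => mul_self_nonneg _
  have hs := mul_self_nonneg s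
  by_contra hle
  have e : l12 * (s * s) + l13 * (∑ x ∈ Finset.univ.erase (i1 hn), v x 0 * v x 0)
      + l23 * (∑ x ∈ Finset.univ.erase (i0 hn), v x 1 * v x 1) ≤ 0 := by
    have : v (i1 hn) 0 = s := rfl
    rw [this] at hle
    linarith
  have p1 := mul_nonneg h12.le hs
  have p2 := mul_nonneg h13.le hS0
  have p3 := mul_nonneg h23.le hS1
  have q1 : s = 0 := mul_self_eq_zero.1
    ((mul_eq_zero.1 (by linarith : l12 * (s * s) = 0)).resolve_left h12.ne')
  have q2 := (mul_eq_zero.1 (by linarith :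
    l13 * (∑ x ∈ Finset.univ.erase (i1 hn), v x 0 * v x 0) = 0)).resolve_left h13.ne'
  have q3 := (mul_eq_zero.1 (by linarith :
    l23 * (∑ x ∈ Finset.univ.erase (i0 hn), v x 1 * v x 1) = 0)).resolve_left h23.ne'
  rw [Finset.sum_eq_zero_iff_of_nonneg fun i _ => mul_self_nonneg _] at q2 q3
  apply hv0
  ext i j
  fin_cases j
  · by_cases hi : i = i1 hn
    · rw [hi]; exact q1
    · exact mul_self_eq_zero.1 (q2 i (Finset.mem_erase.2 ⟨hi, Finset.mem_univ _⟩))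
  · by_cases hi : i = i0 hn
    · rw [hi]; exact h01.trans (by rw [q1, neg_zero]; rfl)
    · exact mul_self_eq_zero.1 (q3 i (Finset.mem_erase.2 ⟨hi, Finset.mem_univ _⟩))

theorem transpose_mul_self_of_mem {R : Matrix (Fin n) (Fin n) ℝ}
    (hR : R ∈ Matrix.specialOrthogonalGroup (Fin n) ℝ) : Rᵀ * R = 1 :=
  (mem_orthogonalGroup_iff' _ _).1 (mem_specialOrthogonalGroup_iff.1 hR).1

theorem exists_eq_mul_of_mem_tangentAt {R : Matrix (Fin n) (Fin n) ℝ} (hR : Rᵀ * R = 1)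
    {F v : Matrix (Fin n) (Fin 2) ℝ} (hv : v ∈ tangentAt n (R * F)) :
    ∃ w ∈ tangentAt n F, v = R * w := by
  have hR' : R * Rᵀ = 1 := mul_eq_one_comm.1 hR
  have e : v = R * (Rᵀ * v) := by rw [← Matrix.mul_assoc, hR', Matrix.one_mul]
  refine ⟨Rᵀ * v, ?_, e⟩
  rw [e] at hv
  exact (mul_mem_tangentAt hR).1 hv

/-- The diagonal metric with positive parameters. -/
def diagMetric (hn : 3 ≤ n) {l12 l13 l23 : ℝ} (h12 : 0 < l12) (h13 : 0 < l13) (h23 : 0 < l23) :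
    InvariantMetric n where
  inner := diagBilin n l12 l13 l23
  symm F _ v _ w _ := by
    change diagForm n l12 l13 l23 F v w = diagForm n l12 l13 l23 F w v
    have h : ∀ p, (vᵀ * w) p p = (wᵀ * v) p p := fun p => by
      rw [← transpose_apply (wᵀ * v), transpose_mul, transpose_transpose]
    simp only [diagForm, h]
    ring
  pos F hF v hv hv0 := by
    change 0 < diagForm n l12 l13 l23 F v v
    obtain ⟨R, hR, rfl⟩ := exists_specialOrthogonal_mul_origin hn hF
    have hR := transpose_mul_self_of_mem hR
    obtain ⟨w, hw, rfl⟩ := exists_eq_mul_of_mem_tangentAt hR hv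
    rw [diagForm_invariant _ _ _ hR]
    refine diagForm_pos_origin hn h12 h13 h23 hw fun h => hv0 ?_
    rw [h, Matrix.mul_zero]
  invariant R hR F _ v _ w _ := diagForm_invariant _ _ _ (transpose_mul_self_of_mem hR) _ _ _

/-- By linearity it is enough to compare the two sides on the spanning ξ_ab of each module, where
both are multiples of one entry of Y. -/
theorem negKilling_eq_diagForm (hn : 3 ≤ n) (l12 l13 l23 : ℝ)
    {X12 X13 X23 Y : Matrix (Fin n) (Fin n) ℝ} (h12 : X12 ∈ m12 n) (h13 : X13 ∈ m13 n)
    (h23 : X23 ∈ m23 n) (hY : Y ∈ TangentAlg n) :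
    diagForm n l12 l13 l23 (origin n) ((X12 + X13 + X23) * origin n) (Y * origin n)
      = negKilling n (l12 • X12 + l13 • X13 + l23 • X23) Y := by
  rw [mem_TangentAlg_iff_entries hn] at hY
  obtain ⟨hY, -⟩ := hY
  have h01 : i0 hn ≠ i1 hn := by simp [i0, i1]
  have hadd : ∀ (A B : Matrix (Fin n) (Fin n) ℝ) C, diagForm n l12 l13 l23 (origin n) ((A + B) * origin n) C
      = diagForm n l12 l13 l23 (origin n) (A * origin n) C
        + diagForm n l12 l13 l23 (origin n) (B * origin n) C := by
    intro A B C
    rw [Matrix.add_mul]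
    exact LinearMap.BilinForm.add_left (B := diagBilin n l12 l13 l23 (origin n)) _ _ _
  have hsmul : ∀ (c : ℝ) (A : Matrix (Fin n) (Fin n) ℝ) C, diagForm n l12 l13 l23 (origin n) ((c • A) * origin n) C
      = c * diagForm n l12 l13 l23 (origin n) (A * origin n) C := by
    intro c A C
    rw [Matrix.smul_mul]
    exact LinearMap.BilinForm.smul_left (B := diagBilin n l12 l13 l23 (origin n)) _ _ _
  have hspan : ∀ (l : ℝ) (S : Set (Matrix (Fin n) (Fin n) ℝ)),
      (∀ A ∈ S, diagForm n l12 l13 l23 (origin n) (A * origin n) (Y * origin n)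
        = l * negKilling n A Y) → ∀ A ∈ Submodule.span ℝ S,
      diagForm n l12 l13 l23 (origin n) (A * origin n) (Y * origin n) = l * negKilling n A Y := by
    intro l S hS A hA
    induction hA using Submodule.span_induction with
    | mem A hA => exact hS A hA
    | zero =>
      have := hsmul 0 0 (Y * origin n)
      rw [zero_smul, zero_mul] at this
      rw [this]
      simp [negKilling]
    | add A B _ _ hA hB => rw [hadd, negKilling_add_left, hA, hB, mul_add]
    | smul c A _ hA => rw [hsmul, negKilling_smul_left, hA]; ring
  have hxi : ∀ i j : Fin n, diagForm n l12 l13 l23 (origin n)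
      (xi n (i.val + 1) (j.val + 1) * origin n) (Y * origin n)
      = 2 * ((n : ℝ) - 2) * ((l12 - l13 - l23) * xi n (i.val + 1) (j.val + 1) (i1 hn) (i0 hn)
        * Y (i1 hn) (i0 hn)
        + l13 * ((if j = i0 hn then Y i (i0 hn) else 0) - if i = i0 hn then Y j (i0 hn) else 0)
        + l23 * ((if j = i1 hn then Y i (i1 hn) else 0) - if i = i1 hn then Y j (i1 hn) else 0)) := by
    intro i j
    rw [diagForm, origin_transpose_mul_apply_one hn, origin_transpose_mul_apply_one hn,
      mul_origin_apply_zero hn, mul_origin_apply_zero hn, mul_apply, mul_apply]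
    simp only [transpose_apply, mul_origin_apply_zero hn, mul_origin_apply_one hn]
    rw [xi_eq_single]
    simp only [Matrix.sub_apply, single_apply, sub_mul, Finset.sum_sub_distrib, ite_and, ite_mul,
      one_mul, zero_mul, Finset.sum_ite_eq, Finset.mem_univ, if_true]
  have d0 : Y (i0 hn) (i0 hn) = 0 := by linarith [hY (i0 hn) (i0 hn)]
  have d1 : Y (i1 hn) (i1 hn) = 0 := by linarith [hY (i1 hn) (i1 hn)]
  have k12 := hspan l12 {xi n 1 2} (by
    rintro A rfl
    refine (hxi (i0 hn) (i1 hn)).trans (Eq.trans ?_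
      (congrArg (l12 * ·) (negKilling_xi (i0 hn) (i1 hn) hY)).symm)
    simp only [xi_apply, h01, h01.symm, hY (i0 hn) (i1 hn)]
    simp [i0, i1]
    ring) X12 h12
  have k13 := hspan l13 _ (by
    rintro A ⟨k, hk, rfl⟩
    obtain ⟨hk3, hkn⟩ := Finset.mem_Icc.1 hk
    obtain ⟨j, rfl⟩ : ∃ j : Fin n, k = j.val + 1 := ⟨⟨k - 1, by omega⟩, by simp; omega⟩
    refine (hxi (i0 hn) j).trans (Eq.trans ?_
      (congrArg (l13 * ·) (negKilling_xi (i0 hn) j hY)).symm)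
    have hj0 : j ≠ i0 hn := by rintro rfl; simp [i0] at hk3
    have hj1 : j ≠ i1 hn := by rintro rfl; simp [i1] at hk3
    have e : xi n ((i0 hn).val + 1) (j.val + 1) (i1 hn) (i0 hn) = 0 := by
      rw [xi_apply, if_neg (by simp [i0, i1]), if_neg (by simp [i1]; omega), sub_zero]
    rw [e, if_neg hj0, if_pos rfl, if_neg hj1, if_neg h01, hY j]
    ring) X13 h13
  have k23 := hspan l23 _ (by
    rintro A ⟨k, hk, rfl⟩
    obtain ⟨hk3, hkn⟩ := Finset.mem_Icc.1 hk
    obtain ⟨j, rfl⟩ : ∃ j : Fin n, k = j.val + 1 := ⟨⟨k - 1, by omega⟩, by simp; omega⟩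
    refine (hxi (i1 hn) j).trans (Eq.trans ?_
      (congrArg (l23 * ·) (negKilling_xi (i1 hn) j hY)).symm)
    have hj0 : j ≠ i0 hn := by rintro rfl; simp [i0] at hk3
    have hj1 : j ≠ i1 hn := by rintro rfl; simp [i1] at hk3
    have e : xi n ((i1 hn).val + 1) (j.val + 1) (i1 hn) (i0 hn) = 0 := by
      rw [xi_apply, if_neg (by simp [i0]; omega), if_neg (by simp [i1, i0]), sub_zero]
    rw [e, if_neg hj0, if_neg h01.symm, if_neg hj1, if_pos rfl, hY j]
    ring) X23 h23
  rw [hadd, hadd, k12, k13, k23]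
  simp only [negKilling_add_left, negKilling_smul_left]

theorem diagMetric_hasOperator (hn : 3 ≤ n) {l12 l13 l23 : ℝ} (h12 : 0 < l12) (h13 : 0 < l13)
    (h23 : 0 < l23) : (diagMetric hn h12 h13 h23).HasOperator l12 l13 l23 :=
  fun _ hX12 _ hX13 _ hX23 _ hY => negKilling_eq_diagForm hn _ _ _ hX12 hX13 hX23 hY

theorem exists_mem_TangentAlg_mul_origin (hn : 3 ≤ n) {v : Matrix (Fin n) (Fin 2) ℝ}
    (hv : v ∈ tangentAt n (origin n)) : ∃ X ∈ TangentAlg n, v = X * origin n := by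
  obtain ⟨h00, h11, h01⟩ := (mem_tangentAt_origin_iff hn).1 hv
  -- The first two columns of a vector of 𝔪 carry its coordinates below the diagonal with a minus
  -- sign.
  let a : ℕ → ℕ → ℝ := fun p q => if h : q - 1 < n then -v ⟨q - 1, h⟩ (if p = 1 then 0 else 1) else 0
  have a1 : ∀ i : Fin n, a 1 (i.val + 1) = -v i 0 := fun i => by simp [a]
  have a2 : ∀ i : Fin n, a 2 (i.val + 1) = -v i 1 := fun i => by simp [a]
  have a12 : a 1 2 = -v (i1 hn) 0 := a1 (i1 hn)
  have e0 : ∀ i : Fin n, i.val = 0 → i = i0 hn := fun i h => Fin.ext h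
  have e1 : ∀ i : Fin n, i.val = 1 → i = i1 hn := fun i h => Fin.ext h
  refine ⟨tangentVec n a, tangentVec_mem_TangentAlg hn a, ?_⟩
  ext i j
  fin_cases j
  · refine Eq.trans ?_ (mul_origin_apply_zero hn _ _).symm
    change v i 0 = _
    rw [tangentVec_apply, a1 i, a12]
    simp only [i0, i1, if_true]
    split_ifs with h1 h2
    · rw [e0 i h1, h00]
    · rw [e1 i h2, neg_neg]; rfl
    · rw [neg_neg]
  · refine Eq.trans ?_ (mul_origin_apply_one hn _ _).symm
    change v i 1 = _
    rw [tangentVec_apply, a2 i, a1 (i1 hn)]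
    have : (i1 hn).val = 1 := rfl
    simp only [this, one_ne_zero, if_true, if_false]
    split_ifs with h1 h2
    · rw [e0 i h1, h01]
    · rw [e1 i h2, h11]
    · rw [neg_neg]

/-- An invariant metric is determined by its operator at the origin. -/
theorem InvariantMetric.HasOperator.inner_eq (hn : 3 ≤ n) {g : InvariantMetric n}
    {l12 l13 l23 : ℝ} (hg : g.HasOperator l12 l13 l23) {F : Matrix (Fin n) (Fin 2) ℝ}
    (hF : F ∈ Frames n) {v w : Matrix (Fin n) (Fin 2) ℝ} (hv : v ∈ tangentAt n F)
    (hw : w ∈ tangentAt n F) : g.inner F v w = diagForm n l12 l13 l23 F v w := by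
  obtain ⟨R, hR, rfl⟩ := exists_specialOrthogonal_mul_origin hn hF
  have hR' := transpose_mul_self_of_mem hR
  obtain ⟨v, hv', rfl⟩ := exists_eq_mul_of_mem_tangentAt hR' hv
  obtain ⟨w, hw', rfl⟩ := exists_eq_mul_of_mem_tangentAt hR' hw
  rw [diagForm_invariant _ _ _ hR', g.invariant R hR _ (origin_mem_Frames hn) v hv' w hw']
  obtain ⟨X, hX, rfl⟩ := exists_mem_TangentAlg_mul_origin hn hv'
  obtain ⟨Y, hY, rfl⟩ := exists_mem_TangentAlg_mul_origin hn hw'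
  obtain ⟨a, rfl⟩ := (mem_TangentAlg_iff hn X).1 hX
  have s12 : a 1 2 • xi n 1 2 ∈ m12 n :=
    Submodule.smul_mem _ _ (Submodule.subset_span rfl)
  have s13 : ∑ k ∈ Finset.Icc 3 n, a 1 k • xi n 1 k ∈ m13 n :=
    Submodule.sum_mem _ fun k hk => Submodule.smul_mem _ _ (Submodule.subset_span ⟨k, hk, rfl⟩)
  have s23 : ∑ k ∈ Finset.Icc 3 n, a 2 k • xi n 2 k ∈ m23 n :=
    Submodule.sum_mem _ fun k hk => Submodule.smul_mem _ _ (Submodule.subset_span ⟨k, hk, rfl⟩)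
  rw [tangentVec, hg _ s12 _ s13 _ s23 _ hY, negKilling_eq_diagForm hn _ _ _ s12 s13 s23 hY]

/-! ### Partial derivatives of functions of two real variables -/

/-- The derivative in the first variable. -/
noncomputable def ds (f : ℝ × ℝ → ℝ) (p : ℝ × ℝ) : ℝ := fderiv ℝ f p (1, 0)

/-- The derivative in the second variable. -/
noncomputable def dt (f : ℝ × ℝ → ℝ) (p : ℝ × ℝ) : ℝ := fderiv ℝ f p (0, 1)

theorem contDiff_ds {f : ℝ × ℝ → ℝ} (hf : ContDiff ℝ ∞ f) : ContDiff ℝ ∞ (ds f) :=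
  (hf.fderiv_right (m := ∞) (by simp)).clm_apply contDiff_const

theorem contDiff_dt {f : ℝ × ℝ → ℝ} (hf : ContDiff ℝ ∞ f) : ContDiff ℝ ∞ (dt f) :=
  (hf.fderiv_right (m := ∞) (by simp)).clm_apply contDiff_const

theorem hasDerivAt_ds {f : ℝ × ℝ → ℝ} (hf : ContDiff ℝ ∞ f) (s t : ℝ) :
    HasDerivAt (fun x => f (x, t)) (ds f (s, t)) s := by
  have h1 : HasFDerivAt f (fderiv ℝ f (s, t)) (s, t) :=
    (hf.differentiable (by simp) (s, t)).hasFDerivAt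
  exact h1.comp_hasDerivAt s ((hasDerivAt_id s).prodMk (hasDerivAt_const s t))

theorem hasDerivAt_dt {f : ℝ × ℝ → ℝ} (hf : ContDiff ℝ ∞ f) (s t : ℝ) :
    HasDerivAt (fun x => f (s, x)) (dt f (s, t)) t := by
  have h1 : HasFDerivAt f (fderiv ℝ f (s, t)) (s, t) :=
    (hf.differentiable (by simp) (s, t)).hasFDerivAt
  exact h1.comp_hasDerivAt t ((hasDerivAt_const t s).prodMk (hasDerivAt_id t))

theorem ds_dt_comm {f : ℝ × ℝ → ℝ} (hf : ContDiff ℝ ∞ f) : ds (dt f) = dt (ds f) := by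
  funext p
  have hd : DifferentiableAt ℝ (fderiv ℝ f) p :=
    (hf.fderiv_right (m := ∞) (by simp)).differentiable (by simp) p
  have key : ∀ v w : ℝ × ℝ, fderiv ℝ (fun q => fderiv ℝ f q v) p w
      = fderiv ℝ (fderiv ℝ f) p w v := by
    intro v w
    rw [fderiv_clm_apply hd (differentiableAt_const v)]
    simp
  have hs : IsSymmSndFDerivAt ℝ f p :=
    hf.contDiffAt.isSymmSndFDerivAt (by
      rw [minSmoothness_of_isRCLikeNormedField]; exact WithTop.coe_le_coe.2 le_top)
  change fderiv ℝ (fun q => fderiv ℝ f q (0, 1)) p (1, 0)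
    = fderiv ℝ (fun q => fderiv ℝ f q (1, 0)) p (0, 1)
  rw [key, key, hs.eq]

/-- Differentiation under the integral sign. -/
theorem hasDerivAt_intervalIntegral {f : ℝ × ℝ → ℝ} (hf : ContDiff ℝ ∞ f) (a b : ℝ) :
    HasDerivAt (fun s => ∫ t in a..b, f (s, t)) (∫ t in a..b, ds f (0, t)) 0 := by
  have hc : Continuous (ds f) := (contDiff_ds hf).continuous
  obtain ⟨C, hC⟩ := ((isCompact_Icc (a := (-1 : ℝ)) (b := 1)).prod
    (isCompact_uIcc (a := a) (b := b))).exists_bound_of_continuousOn hc.continuousOn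
  refine (intervalIntegral.hasDerivAt_integral_of_dominated_loc_of_deriv_le
    (F := fun s t => f (s, t)) (F' := fun s t => ds f (s, t)) (bound := fun _ => C)
    (Icc_mem_nhds (by norm_num : (-1 : ℝ) < 0) one_pos) ?_ ?_ ?_ ?_ ?_ ?_).2
  · refine Filter.Eventually.of_forall fun s => ?_
    exact (hf.continuous.comp (Continuous.prodMk_right s)).aestronglyMeasurable
  · exact (hf.continuous.comp (Continuous.prodMk_right 0)).intervalIntegrable _ _
  · exact (hc.comp (Continuous.prodMk_right 0)).aestronglyMeasurable
  · exact Filter.Eventually.of_forall fun t ht s hs =>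
      hC (s, t) ⟨hs, Set.uIoc_subset_uIcc ht⟩
  · exact intervalIntegrable_const
  · exact Filter.Eventually.of_forall fun t _ s _ => hasDerivAt_ds hf s t

/-! ### First variation of the energy -/

/-- The Lagrangian in terms of the components of a family of frames `(u, v)`. -/
noncomputable def lagrangian (α β δ : ℝ) (u v : Fin n → ℝ × ℝ → ℝ) (p : ℝ × ℝ) : ℝ :=
  α * ((∑ i, v i p * dt (u i) p) * (∑ i, v i p * dt (u i) p))
    + β * (∑ i, dt (u i) p * dt (u i) p) + δ * (∑ i, dt (v i) p * dt (v i) p)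

theorem contDiff_lagrangian (α β δ : ℝ) {u v : Fin n → ℝ × ℝ → ℝ}
    (hu : ∀ i, ContDiff ℝ ∞ (u i)) (hv : ∀ i, ContDiff ℝ ∞ (v i)) :
    ContDiff ℝ ∞ (lagrangian α β δ u v) := by
  have hu' := fun i => contDiff_dt (hu i)
  have hv' := fun i => contDiff_dt (hv i)
  have h1 : ContDiff ℝ ∞ fun p => ∑ i, v i p * dt (u i) p :=
    ContDiff.sum fun i _ => (hv i).mul (hu' i)
  have h2 : ContDiff ℝ ∞ fun p => ∑ i, dt (u i) p * dt (u i) p :=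
    ContDiff.sum fun i _ => (hu' i).mul (hu' i)
  have h3 : ContDiff ℝ ∞ fun p => ∑ i, dt (v i) p * dt (v i) p :=
    ContDiff.sum fun i _ => (hv' i).mul (hv' i)
  exact ((contDiff_const.mul (h1.mul h1)).add (contDiff_const.mul h2)).add (contDiff_const.mul h3)

/-- The mixed derivatives are exchanged so that the t-derivative acts on the variation, ready for
integration by parts. -/
theorem ds_lagrangian (α β δ : ℝ) {u v : Fin n → ℝ × ℝ → ℝ}
    (hu : ∀ i, ContDiff ℝ ∞ (u i)) (hv : ∀ i, ContDiff ℝ ∞ (v i)) (s t : ℝ) :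
    ds (lagrangian α β δ u v) (s, t) =
      2 * (α * (∑ i, v i (s, t) * dt (u i) (s, t))
          * (∑ i, (ds (v i) (s, t) * dt (u i) (s, t) + v i (s, t) * dt (ds (u i)) (s, t)))
        + β * (∑ i, dt (u i) (s, t) * dt (ds (u i)) (s, t))
        + δ * (∑ i, dt (v i) (s, t) * dt (ds (v i)) (s, t))) := by
  have du := fun i => hasDerivAt_ds (contDiff_dt (hu i)) s t
  have dv := fun i => hasDerivAt_ds (contDiff_dt (hv i)) s t
  simp only [ds_dt_comm (hu _)] at du
  simp only [ds_dt_comm (hv _)] at dv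
  have h1 := HasDerivAt.fun_sum (u := Finset.univ)
    fun i _ => (hasDerivAt_ds (hv i) s t).mul (du i)
  have h2 := HasDerivAt.fun_sum (u := Finset.univ) fun i _ => (du i).mul (du i)
  have h3 := HasDerivAt.fun_sum (u := Finset.univ) fun i _ => (dv i).mul (dv i)
  have h := (((h1.mul h1).const_mul α).add (h2.const_mul β)).add (h3.const_mul δ)
  refine ((hasDerivAt_ds (contDiff_lagrangian α β δ hu hv) s t).unique h).trans ?_
  have e : ∀ x : Fin n → ℝ, ∀ y : Fin n → ℝ,
      ∑ i, (x i * y i + y i * x i) = 2 * ∑ i, y i * x i := by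
    intro x y
    rw [Finset.mul_sum]
    exact Finset.sum_congr rfl fun i _ => by ring
  rw [e (fun i => dt (ds (u i)) (s, t)) fun i => dt (u i) (s, t),
    e (fun i => dt (ds (v i)) (s, t)) fun i => dt (v i) (s, t)]
  simp only [Pi.mul_apply]
  ring

/-- Integration by parts. Because ⟨v, u'⟩ equals the constant h along the base curve, no derivative
of it appears, and the remaining factors are linear in the derivatives of u and v. -/
theorem hasDerivAt_integral_lagrangian (α β δ h : ℝ) {u v : Fin n → ℝ × ℝ → ℝ} {a b : ℝ}
    (hu : ∀ i, ContDiff ℝ ∞ (u i)) (hv : ∀ i, ContDiff ℝ ∞ (v i))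
    (hh : ∀ t, ∑ i, v i (0, t) * dt (u i) (0, t) = h)
    (hua : ∀ i, ds (u i) (0, a) = 0) (hub : ∀ i, ds (u i) (0, b) = 0)
    (hva : ∀ i, ds (v i) (0, a) = 0) (hvb : ∀ i, ds (v i) (0, b) = 0) :
    HasDerivAt (fun s => 1 / 2 * ∫ t in a..b, lagrangian α β δ u v (s, t))
      (∫ t in a..b, ∑ i,
        (ds (u i) (0, t) * (-α * h * dt (v i) (0, t) - β * dt (dt (u i)) (0, t))
          + ds (v i) (0, t) * (α * h * dt (u i) (0, t) - δ * dt (dt (v i)) (0, t)))) 0 := by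
  have hL := contDiff_lagrangian α β δ hu hv
  refine ((hasDerivAt_intervalIntegral hL a b).const_mul (1 / 2)).congr_deriv ?_
  have r : ∀ {f : ℝ × ℝ → ℝ}, ContDiff ℝ ∞ f → Continuous fun t => f (0, t) :=
    fun hf => hf.continuous.comp (Continuous.prodMk_right 0)
  let G : ℝ → ℝ := fun t => ∑ i,
        (ds (u i) (0, t) * (-α * h * dt (v i) (0, t) - β * dt (dt (u i)) (0, t))
          + ds (v i) (0, t) * (α * h * dt (u i) (0, t) - δ * dt (dt (v i)) (0, t)))
  -- `K` is the boundary term, zero at both ends; half the s-derivative of the Lagrangian is `K' +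
  -- G`.
  let K : ℝ → ℝ := fun t => ∑ i, ((α * h) * (v i (0, t) * ds (u i) (0, t))
      + β * (dt (u i) (0, t) * ds (u i) (0, t)) + δ * (dt (v i) (0, t) * ds (v i) (0, t)))
  let K' : ℝ → ℝ := fun t => ∑ i,
    ((α * h) * (dt (v i) (0, t) * ds (u i) (0, t) + v i (0, t) * dt (ds (u i)) (0, t))
      + β * (dt (dt (u i)) (0, t) * ds (u i) (0, t) + dt (u i) (0, t) * dt (ds (u i)) (0, t))
      + δ * (dt (dt (v i)) (0, t) * ds (v i) (0, t) + dt (v i) (0, t) * dt (ds (v i)) (0, t)))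
  have hK : ∀ t, HasDerivAt K (K' t) t := by
    intro t
    refine HasDerivAt.fun_sum fun i _ => ?_
    have a1 := (hasDerivAt_dt (hv i) 0 t).mul (hasDerivAt_dt (contDiff_ds (hu i)) 0 t)
    have a2 := (hasDerivAt_dt (contDiff_dt (hu i)) 0 t).mul
      (hasDerivAt_dt (contDiff_ds (hu i)) 0 t)
    have a3 := (hasDerivAt_dt (contDiff_dt (hv i)) 0 t).mul
      (hasDerivAt_dt (contDiff_ds (hv i)) 0 t)
    exact ((a1.const_mul (α * h)).add (a2.const_mul β)).add (a3.const_mul δ)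
  have cu := fun i => r (hu i)
  have cv := fun i => r (hv i)
  have cdu := fun i => r (contDiff_dt (hu i))
  have cdv := fun i => r (contDiff_dt (hv i))
  have csu := fun i => r (contDiff_ds (hu i))
  have csv := fun i => r (contDiff_ds (hv i))
  have cddu := fun i => r (contDiff_dt (contDiff_dt (hu i)))
  have cddv := fun i => r (contDiff_dt (contDiff_dt (hv i)))
  have cdsu := fun i => r (contDiff_dt (contDiff_ds (hu i)))
  have cdsv := fun i => r (contDiff_dt (contDiff_ds (hv i)))
  have cK' : Continuous K' := by fun_prop
  have cG : Continuous G := by fun_prop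
  have hint : ∫ t in a..b, K' t = 0 := by
    rw [intervalIntegral.integral_eq_sub_of_hasDerivAt (fun t _ => hK t)
      (cK'.intervalIntegrable _ _)]
    simp [K, hua, hub, hva, hvb]
  rw [← intervalIntegral.integral_const_mul]
  have e : ∀ t, 1 / 2 * ds (lagrangian α β δ u v) (0, t) = K' t + G t := by
    intro t
    rw [ds_lagrangian α β δ hu hv, hh]
    simp only [K', G, Finset.mul_sum, ← Finset.sum_add_distrib]
    refine Finset.sum_congr rfl fun i _ => ?_
    ring
  simp only [e]
  rw [intervalIntegral.integral_add (cK'.intervalIntegrable _ _) (cG.intervalIntegrable _ _), hint,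
    zero_add]

/-! ### The matrix exponential -/

section Exp

attribute [local instance] Matrix.linftyOpNormedRing Matrix.linftyOpNormedAlgebra

theorem hasDerivAt_exp_smul_entry (X : Matrix (Fin n) (Fin n) ℝ) (t : ℝ) (i k : Fin n) :
    HasDerivAt (fun u : ℝ => NormedSpace.exp (u • X) i k) ((NormedSpace.exp (t • X) * X) i k) t := by
  have h := hasDerivAt_exp_smul_const (𝕂 := ℝ) X t
  exact (LinearMap.toContinuousLinearMap
    (Matrix.entryLinearMap ℝ ℝ i k)).hasFDerivAt.comp_hasDerivAt t h

theorem contDiff_exp_smul_entry (X : Matrix (Fin n) (Fin n) ℝ) (i k : Fin n) :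
    ContDiff ℝ ∞ (fun u : ℝ => NormedSpace.exp (u • X) i k) := by
  have h : ContDiff ℝ ∞ (NormedSpace.exp : Matrix (Fin n) (Fin n) ℝ → _) :=
    contDiff_iff_contDiffAt.2 fun x => (NormedSpace.exp_analytic (𝕂 := ℝ) x).contDiffAt
  have h2 : ContDiff ℝ ∞ fun u : ℝ => u • X := contDiff_id.smul contDiff_const
  exact (LinearMap.toContinuousLinearMap
    (Matrix.entryLinearMap ℝ ℝ i k)).contDiff.comp (h.comp h2)

end Exp

theorem transpose_exp_mul_exp {X : Matrix (Fin n) (Fin n) ℝ} (hX : Xᵀ = -X) :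
    (NormedSpace.exp X)ᵀ * NormedSpace.exp X = 1 := by
  rw [← Matrix.exp_transpose, hX, ← Matrix.exp_add_of_commute _ _ (Commute.refl X).neg_left,
    neg_add_cancel, NormedSpace.exp_zero]

/-- With `X` placed next to `C`, the second derivative follows by replacing `C` with `X * C`. -/
theorem hasDerivAt_exp_mul_entry (X : Matrix (Fin n) (Fin n) ℝ) (C : Matrix (Fin n) (Fin 2) ℝ)
    (t : ℝ) (i : Fin n) (j : Fin 2) :
    HasDerivAt (fun u : ℝ => (NormedSpace.exp (u • X) * C) i j)
      ((NormedSpace.exp (t • X) * (X * C)) i j) t := by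
  rw [← Matrix.mul_assoc]
  simp only [Matrix.mul_apply (N := C)]
  exact HasDerivAt.fun_sum fun k _ => (hasDerivAt_exp_smul_entry X t i k).mul_const _

theorem contDiff_orbitCurve (X : Matrix (Fin n) (Fin n) ℝ) (i : Fin n) (j : Fin 2) :
    ContDiff ℝ ∞ fun t => orbitCurve X t i j := by
  simp only [orbitCurve, Matrix.mul_apply (N := origin n)]
  exact ContDiff.sum fun k _ => (contDiff_exp_smul_entry X i k).mul contDiff_const

theorem orbitCurve_mem_Frames (hn : 3 ≤ n) {X : Matrix (Fin n) (Fin n) ℝ} (hX : Xᵀ = -X) (t : ℝ) :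
    orbitCurve X t ∈ Frames n :=
  mul_mem_Frames (transpose_exp_mul_exp (by rw [transpose_smul, hX, smul_neg]))
    (origin_mem_Frames hn)

/-! ### Variations of homogeneous curves -/

/-- The matrix that represents the Euler–Lagrange operator along `exp(tX) · o`. -/
def eulerMat (hn : 3 ≤ n) (l12 l13 l23 : ℝ) (X : Matrix (Fin n) (Fin n) ℝ) :
    Matrix (Fin n) (Fin 2) ℝ :=
  -- The columns are the two brackets of the first variation at t = 0: h is the entry X₂₁, first
  -- derivatives are columns of X and second derivatives are columns of X².
  of fun i j => if j = 0 then
      -(l12 - l13 - l23) * X (i1 hn) (i0 hn) * X i (i1 hn) - l13 * (X * X) i (i0 hn)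
    else (l12 - l13 - l23) * X (i1 hn) (i0 hn) * X i (i0 hn) - l23 * (X * X) i (i1 hn)

/-- A component of a variation, as a function of two variables. -/
def component (Γ : ℝ → ℝ → Matrix (Fin n) (Fin 2) ℝ) (j : Fin 2) (i : Fin n) (p : ℝ × ℝ) : ℝ :=
  Γ p.1 p.2 i j

/-- The variation field. -/
noncomputable def variationField (Γ : ℝ → ℝ → Matrix (Fin n) (Fin 2) ℝ) (t : ℝ) :
    Matrix (Fin n) (Fin 2) ℝ :=
  of fun i j => ds (component Γ j i) (0, t)

theorem frame_sum {F : Matrix (Fin n) (Fin 2) ℝ} (hF : F ∈ Frames n) (p q : Fin 2) :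
    ∑ i, F i p * F i q = (1 : Matrix (Fin 2) (Fin 2) ℝ) p q := by
  have := congrFun (congrFun (show Fᵀ * F = 1 from hF) p) q
  rwa [mul_apply] at this

/-- Differentiate Fᵀ F = 1. This serves velocities (in t) as well as variation fields (in s). -/
theorem mem_tangentAt_of_hasDerivAt {c : ℝ → Matrix (Fin n) (Fin 2) ℝ}
    {w : Matrix (Fin n) (Fin 2) ℝ} {t : ℝ} (hc : ∀ t, c t ∈ Frames n)
    (hw : ∀ i j, HasDerivAt (fun x => c x i j) (w i j) t) : w ∈ tangentAt n (c t) := by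
  change (c t)ᵀ * w + wᵀ * c t = 0
  ext p q
  have h := HasDerivAt.fun_sum (u := Finset.univ) fun i _ => (hw i p).mul (hw i q)
  have h' : HasDerivAt (fun x => ∑ i, c x i p * c x i q) 0 t := by
    simp only [frame_sum (hc _)]
    exact hasDerivAt_const _ _
  have e := h.unique h'
  rw [Matrix.add_apply, mul_apply, mul_apply, ← Finset.sum_add_distrib, Matrix.zero_apply, ← e]
  refine Finset.sum_congr rfl fun i _ => ?_
  simp only [transpose_apply]
  ring

theorem trace_transpose_mul (A B : Matrix (Fin n) (Fin 2) ℝ) :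
    (Aᵀ * B).trace = ∑ i, (A i 0 * B i 0 + A i 1 * B i 1) := by
  simp only [trace, diag_apply, mul_apply, transpose_apply, Fin.sum_univ_two,
    Finset.sum_add_distrib]

/-- Velocities are tangent, so the energy is the integral of `lagrangian`; all t-derivatives of the
base curve carry exp(tX) on the left, which factors out of the integrand. -/
theorem hasDerivAt_energy (hn : 3 ≤ n) {g : InvariantMetric n} {l12 l13 l23 : ℝ}
    (hg : g.HasOperator l12 l13 l23) {X : Matrix (Fin n) (Fin n) ℝ} (hX : Xᵀ = -X) {a b : ℝ}
    {Γ : ℝ → ℝ → Matrix (Fin n) (Fin 2) ℝ} (hΓ : IsProperVariation (orbitCurve X) a b Γ) :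
    HasDerivAt (fun s => g.energy a b (Γ s))
      (2 * ((n : ℝ) - 2) * ∫ t in a..b,
        ((variationField Γ t)ᵀ * (NormedSpace.exp (t • X) * eulerMat hn l12 l13 l23 X)).trace)
      0 := by
  have hs : ∀ j i, ContDiff ℝ ∞ (component Γ j i) := fun j i => hΓ.smooth i j
  have hvel : ∀ s t i j, velocity (Γ s) t i j = dt (component Γ j i) (s, t) := fun s t i j =>
    (hasDerivAt_dt (hs j i) s t).deriv
  have hbase : ∀ i j t, component Γ j i (0, t) = orbitCurve X t i j := fun i j t => by
    simp only [component, hΓ.base]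
  have hdt : ∀ i j t, dt (component Γ j i) (0, t)
      = (NormedSpace.exp (t • X) * (X * origin n)) i j := fun i j t => by
    refine (hasDerivAt_dt (hs j i) 0 t).unique ?_
    simp only [hbase]
    exact hasDerivAt_exp_mul_entry X (origin n) t i j
  have hdtt : ∀ i j t, dt (dt (component Γ j i)) (0, t)
      = (NormedSpace.exp (t • X) * (X * (X * origin n))) i j := fun i j t => by
    refine (hasDerivAt_dt (contDiff_dt (hs j i)) 0 t).unique ?_
    simp only [hdt]
    exact hasDerivAt_exp_mul_entry X (X * origin n) t i j
  have hend : ∀ c, (∀ s, Γ s c = orbitCurve X c) → ∀ i j, ds (component Γ j i) (0, c) = 0 := by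
    intro c hc i j
    refine (hasDerivAt_ds (hs j i) 0 c).unique ?_
    simp only [component, hc]
    exact hasDerivAt_const _ _
  have hE : ∀ t : ℝ, (NormedSpace.exp (t • X))ᵀ * NormedSpace.exp (t • X) = 1 := fun t =>
    transpose_exp_mul_exp (by rw [transpose_smul, hX, smul_neg])
  -- The conserved product ⟨v, u'⟩: the orthogonal exp(tX) drops out.
  have hh : ∀ t, ∑ i, component Γ 1 i (0, t) * dt (component Γ 0 i) (0, t)
      = X (i1 hn) (i0 hn) := by
    intro t
    have h1 : ((NormedSpace.exp (t • X) * origin n)ᵀ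
        * (NormedSpace.exp (t • X) * (X * origin n))) 1 0 = X (i1 hn) (i0 hn) := by
      rw [transpose_mul, Matrix.mul_assoc, ← Matrix.mul_assoc _ᵀ (NormedSpace.exp _), hE,
        Matrix.one_mul, origin_transpose_mul_apply_one hn, mul_origin_apply_zero hn]
    rw [← h1, mul_apply]
    refine Finset.sum_congr rfl fun i _ => ?_
    rw [hbase, hdt, transpose_apply]
    rfl
  have key := hasDerivAt_integral_lagrangian (l12 - l13 - l23) l13 l23 (X (i1 hn) (i0 hn)) (a := a) (b := b)
    (hs 0) (hs 1) hh (fun i => hend a hΓ.left i 0) (fun i => hend b hΓ.right i 0)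
    (fun i => hend a hΓ.left i 1) (fun i => hend b hΓ.right i 1)
  have henergy : (fun s => g.energy a b (Γ s)) = fun s => 2 * ((n : ℝ) - 2) *
      (1 / 2 * ∫ t in a..b,
        lagrangian (l12 - l13 - l23) l13 l23 (component Γ 0) (component Γ 1) (s, t)) := by
    funext s
    rw [InvariantMetric.energy, mul_left_comm (2 * ((n : ℝ) - 2)),
      ← intervalIntegral.integral_const_mul (2 * ((n : ℝ) - 2))]
    congr 1
    refine intervalIntegral.integral_congr fun t _ => ?_
    have ht : velocity (Γ s) t ∈ tangentAt n (Γ s t) :=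
      mem_tangentAt_of_hasDerivAt (hΓ.mem s) fun i j => by
        rw [hvel]
        exact hasDerivAt_dt (hs j i) s t
    change g.inner (Γ s t) (velocity (Γ s) t) (velocity (Γ s) t) = _
    rw [hg.inner_eq hn (hΓ.mem s t) ht ht]
    simp only [diagForm, lagrangian, mul_apply, transpose_apply, hvel]
    rw [mul_assoc (l12 - l13 - l23)]
    rfl
  rw [henergy]
  refine (key.const_mul _).congr_deriv ?_
  congr 1
  refine intervalIntegral.integral_congr fun t _ => ?_
  simp only [trace_transpose_mul, hdt, hdtt]
  refine Finset.sum_congr rfl fun i _ => ?_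
  have c0 : ∀ k, eulerMat hn l12 l13 l23 X k 0 = -(l12 - l13 - l23) * X (i1 hn) (i0 hn)
      * (X * origin n) k 1 - l13 * (X * (X * origin n)) k 0 := fun k => by
    rw [← Matrix.mul_assoc, mul_origin_apply_zero hn, mul_origin_apply_one hn]
    rfl
  have c1 : ∀ k, eulerMat hn l12 l13 l23 X k 1 = (l12 - l13 - l23) * X (i1 hn) (i0 hn)
      * (X * origin n) k 0 - l23 * (X * (X * origin n)) k 1 := fun k => by
    rw [← Matrix.mul_assoc, mul_origin_apply_zero hn, mul_origin_apply_one hn]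
    rfl
  -- Left multiplication acts column by column, so a column may combine different columns of two
  -- matrices.
  have lin : ∀ (E : Matrix (Fin n) (Fin n) ℝ) (x y : ℝ) (C D B : Matrix (Fin n) (Fin 2) ℝ)
      (j j1 j2 : Fin 2), (∀ k, B k j = x * C k j1 - y * D k j2) →
      (E * B) i j = x * (E * C) i j1 - y * (E * D) i j2 := by
    intro E x y C D B j j1 j2 h
    simp only [mul_apply, Finset.mul_sum, ← Finset.sum_sub_distrib, h]
    exact Finset.sum_congr rfl fun k _ => by ring
  rw [lin _ _ _ _ _ _ 0 1 0 c0, lin _ _ _ _ _ _ 1 0 1 c1]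
  rfl

theorem variationField_mem_tangentAt {γ : ℝ → Matrix (Fin n) (Fin 2) ℝ} {a b : ℝ}
    {Γ : ℝ → ℝ → Matrix (Fin n) (Fin 2) ℝ} (hΓ : IsProperVariation γ a b Γ) (t : ℝ) :
    variationField Γ t ∈ tangentAt n (γ t) := by
  rw [← hΓ.base t]
  exact mem_tangentAt_of_hasDerivAt (c := fun s => Γ s t) (fun s => hΓ.mem s t) fun i j =>
    hasDerivAt_ds (hΓ.smooth i j) 0 t

/-- The variation `exp(tX) exp(s φ(t) Y) o` with `φ(t) = t (1 - t)`. -/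
noncomputable def testVariation (X Y : Matrix (Fin n) (Fin n) ℝ) (s t : ℝ) :
    Matrix (Fin n) (Fin 2) ℝ :=
  NormedSpace.exp (t • X) * (NormedSpace.exp ((s * (t * (1 - t))) • Y) * origin n)

theorem testVariation_isProperVariation (hn : 3 ≤ n) {X Y : Matrix (Fin n) (Fin n) ℝ}
    (hX : Xᵀ = -X) (hY : Yᵀ = -Y) :
    IsProperVariation (orbitCurve X) 0 1 (testVariation X Y) where
  smooth i j := by
    simp only [testVariation, mul_apply]
    refine ContDiff.sum fun k _ => ?_
    refine ((contDiff_exp_smul_entry X i k).comp contDiff_snd).mul (ContDiff.sum fun l _ => ?_)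
    refine ContDiff.mul ?_ contDiff_const
    refine (contDiff_exp_smul_entry Y k l).comp (g := fun u : ℝ => NormedSpace.exp (u • Y) k l)
      (f := fun p : ℝ × ℝ => p.1 * (p.2 * (1 - p.2))) ?_
    fun_prop
  mem s t := mul_mem_Frames (transpose_exp_mul_exp (by rw [transpose_smul, hX, smul_neg]))
    (mul_mem_Frames (transpose_exp_mul_exp (by rw [transpose_smul, hY, smul_neg]))
      (origin_mem_Frames hn))
  base t := by simp [testVariation, orbitCurve]
  left s := by simp [testVariation, orbitCurve]
  right s := by simp [testVariation, orbitCurve]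

theorem variationField_testVariation (hn : 3 ≤ n) {X Y : Matrix (Fin n) (Fin n) ℝ}
    (hX : Xᵀ = -X) (hY : Yᵀ = -Y) (t : ℝ) :
    variationField (testVariation X Y) t
      = NormedSpace.exp (t • X) * ((t * (1 - t)) • (Y * origin n)) := by
  ext i j
  refine (hasDerivAt_ds ((testVariation_isProperVariation hn hX hY).smooth i j) 0 t).unique ?_
  simp only [testVariation]
  rw [mul_apply]
  simp only [mul_apply (M := NormedSpace.exp (t • X))]
  refine HasDerivAt.fun_sum fun k _ => HasDerivAt.const_mul _ ?_
  have h1 : HasDerivAt (fun s : ℝ => s * (t * (1 - t))) (t * (1 - t)) 0 := by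
    simpa using (hasDerivAt_id (0 : ℝ)).mul_const (t * (1 - t))
  have h2 := hasDerivAt_exp_mul_entry Y (origin n) (0 * (t * (1 - t))) k j
  refine (h2.comp (0 : ℝ) h1).congr_deriv ?_
  simp [mul_comm]

/-- Pulled back by exp(tX), a variation field is tangent at the origin, hence of the form Y · o, and
it pairs with a constant matrix. The test variations realise each Y up to a scalar function of t. -/
theorem energy_criterion (hn : 3 ≤ n) {g : InvariantMetric n} {l12 l13 l23 : ℝ}
    (hg : g.HasOperator l12 l13 l23) {X : Matrix (Fin n) (Fin n) ℝ} (hX : Xᵀ = -X) :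
    g.IsGeodesic (orbitCurve X) ↔
      ∀ Y ∈ TangentAlg n, ((Y * origin n)ᵀ * eulerMat hn l12 l13 l23 X).trace = 0 := by
  have hE : ∀ t : ℝ, (NormedSpace.exp (t • X))ᵀ * NormedSpace.exp (t • X) = 1 := fun t =>
    transpose_exp_mul_exp (by rw [transpose_smul, hX, smul_neg])
  have hcancel : ∀ (t : ℝ) (P : Matrix (Fin n) (Fin 2) ℝ),
      ((NormedSpace.exp (t • X) * P)ᵀ * (NormedSpace.exp (t • X) * eulerMat hn l12 l13 l23 X)).trace
        = (Pᵀ * eulerMat hn l12 l13 l23 X).trace := by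
    intro t P
    rw [transpose_mul, Matrix.mul_assoc, ← Matrix.mul_assoc _ᵀ (NormedSpace.exp _), hE,
      Matrix.one_mul]
  constructor
  · intro h Y hYm
    have hY : Yᵀ = -Y := (LieAlgebra.Orthogonal.mem_so _ _ Y).1 hYm.1
    have hΓ := testVariation_isProperVariation hn hX hY
    have h1 := (hasDerivAt_energy hn hg hX hΓ).unique (h.2.2 0 1 one_pos _ hΓ)
    have h2 := (mul_eq_zero.1 h1).resolve_left (two_mul_sub_pos hn).ne'
    simp only [variationField_testVariation hn hX hY, hcancel, transpose_smul, Matrix.smul_mul,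
      trace_smul, smul_eq_mul] at h2
    rw [intervalIntegral.integral_mul_const] at h2
    refine (mul_eq_zero.1 h2).resolve_left ?_
    -- The cut-off has nonzero integral, so the constant pairing itself must vanish.
    have : ∫ t : ℝ in (0 : ℝ)..1, t * (1 - t) = 1 / 6 := by
      have e : ∀ t : ℝ, t * (1 - t) = t - t ^ 2 := fun t => by ring
      simp only [e]
      rw [intervalIntegral.integral_sub (by simp) (by simp)]
      simp
      norm_num
    rw [this]
    norm_num
  · intro h
    refine ⟨contDiff_orbitCurve X, orbitCurve_mem_Frames hn hX, fun a b _ Γ hΓ => ?_⟩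
    refine (hasDerivAt_energy hn hg hX hΓ).congr_deriv ?_
    refine mul_eq_zero_of_right _ ?_
    refine (intervalIntegral.integral_congr (g := fun _ => (0 : ℝ)) fun t _ => ?_).trans (by simp)
    obtain ⟨w, hw, e⟩ := exists_eq_mul_of_mem_tangentAt (hE t)
      (variationField_mem_tangentAt hΓ t)
    obtain ⟨Y, hY, rfl⟩ := exists_mem_TangentAlg_mul_origin hn hw
    simp only [e, hcancel]
    exact h Y hY

/-! ### The algebraic system -/

/-- Passes from row indices 0, …, n - 1 to labels 3, …, n. -/
theorem sum_Icc_three (f : ℕ → ℝ) :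
    ∑ i : Fin n, (if i.val < 2 then 0 else f (i.val + 1)) = ∑ k ∈ Finset.Icc 3 n, f k := by
  rw [Fin.sum_univ_eq_sum_range (fun i => if i < 2 then 0 else f (i + 1)) n]
  refine (Finset.sum_subset_zero_on_sdiff (s₁ := (Finset.Ico 2 n)) (f := fun i => f (i + 1))
    (fun i hi => ?_) (fun i hi => ?_) (fun i hi => ?_)).symm.trans ?_
  · simp only [Finset.mem_Ico] at hi
    simpa using hi.2
  · simp only [Finset.mem_sdiff, Finset.mem_range, Finset.mem_Ico] at hi
    exact if_pos (by omega)
  · simp only [Finset.mem_Ico] at hi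
    exact (if_neg (by omega)).symm
  · rw [Finset.sum_Ico_add' f 2 n 1]
    rfl

theorem tangentVec_zero_apply (hn : 3 ≤ n) (a : ℕ → ℕ → ℝ) (j : Fin n) :
    tangentVec n a (i0 hn) j = if j.val = 0 then 0 else a 1 (j.val + 1) := by
  rw [tangentVec_apply, if_pos (show (i0 hn).val = 0 from rfl)]

theorem tangentVec_one_apply (hn : 3 ≤ n) (a : ℕ → ℕ → ℝ) (j : Fin n) :
    tangentVec n a (i1 hn) j =
      if j.val = 0 then -a 1 2 else if j.val = 1 then 0 else a 2 (j.val + 1) := by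
  rw [tangentVec_apply, if_neg (by simp [i1]), if_pos (show (i1 hn).val = 1 from rfl)]

theorem tangentVec_apply_of_two_le (a : ℕ → ℕ → ℝ) {i : Fin n} (hi : 2 ≤ i.val) (j : Fin n) :
    tangentVec n a i j = if j.val = 0 then -a 1 (i.val + 1)
      else if j.val = 1 then -a 2 (i.val + 1) else 0 := by
  rw [tangentVec_apply, if_neg (by omega), if_neg (by omega)]

theorem tangentVec_sq_zero_one (hn : 3 ≤ n) (a : ℕ → ℕ → ℝ) :
    (tangentVec n a * tangentVec n a) (i0 hn) (i1 hn)
      = -∑ k ∈ Finset.Icc 3 n, a 1 k * a 2 k := by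
  rw [← Finset.sum_neg_distrib, ← sum_Icc_three, mul_apply]
  refine Finset.sum_congr rfl fun i _ => ?_
  rw [tangentVec_zero_apply]
  rcases lt_or_ge i.val 2 with hi | hi
  · rw [if_pos hi]
    by_cases h : i.val = 0
    · rw [if_pos h, zero_mul]
    · obtain rfl : i = i1 hn := Fin.ext (show i.val = 1 by omega)
      rw [tangentVec_one_apply]
      simp [i1]
  · rw [if_neg (by omega), if_neg (by omega), tangentVec_apply_of_two_le a hi]
    simp [i1]

theorem tangentVec_sq_one_zero (hn : 3 ≤ n) (a : ℕ → ℕ → ℝ) :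
    (tangentVec n a * tangentVec n a) (i1 hn) (i0 hn)
      = -∑ k ∈ Finset.Icc 3 n, a 1 k * a 2 k := by
  have hX : (tangentVec n a)ᵀ = -tangentVec n a :=
    (LieAlgebra.Orthogonal.mem_so _ _ _).1 (tangentVec_mem_TangentAlg hn a).1
  have h : (tangentVec n a * tangentVec n a)ᵀ = tangentVec n a * tangentVec n a := by
    rw [transpose_mul, hX, Matrix.neg_mul, Matrix.mul_neg, neg_neg]
  rw [← tangentVec_sq_zero_one hn, ← transpose_apply (tangentVec n a * _), h]

/-- Rows below the second are supported in the first two columns, and the diagonal of X is zero, so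
one term survives. -/
theorem tangentVec_sq_apply_zero (hn : 3 ≤ n) (a : ℕ → ℕ → ℝ) {i : Fin n} (hi : 2 ≤ i.val) :
    (tangentVec n a * tangentVec n a) i (i0 hn) = a 1 2 * a 2 (i.val + 1) := by
  rw [mul_apply, Finset.sum_eq_single (i1 hn)]
  · rw [tangentVec_apply_of_two_le a hi, tangentVec_one_apply]
    simp [i0, i1, mul_comm]
  · intro k _ hk
    have hk : k.val ≠ 1 := fun h => hk (Fin.ext h)
    by_cases h : k.val = 0
    · obtain rfl : k = i0 hn := Fin.ext h
      rw [tangentVec_zero_apply]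
      simp [i0]
    · rw [tangentVec_apply_of_two_le a hi, if_neg h, if_neg hk, zero_mul]
  · simp

theorem tangentVec_sq_apply_one (hn : 3 ≤ n) (a : ℕ → ℕ → ℝ) {i : Fin n} (hi : 2 ≤ i.val) :
    (tangentVec n a * tangentVec n a) i (i1 hn) = -(a 1 2 * a 1 (i.val + 1)) := by
  rw [mul_apply, Finset.sum_eq_single (i0 hn)]
  · rw [tangentVec_apply_of_two_le a hi, tangentVec_zero_apply]
    simp [i0, i1, mul_comm]
  · intro k _ hk
    have hk : k.val ≠ 0 := fun h => hk (Fin.ext h)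
    by_cases h : k.val = 1
    · obtain rfl : k = i1 hn := Fin.ext h
      rw [tangentVec_one_apply]
      simp [i1]
    · rw [tangentVec_apply_of_two_le a hi, if_neg hk, if_neg h, zero_mul]
  · simp

/-- In rows below the second, the coefficient l₁₂ - l₁₃ - l₂₃ of the first-order terms combines with
l₁₃ or l₂₃ from X², leaving a difference of two parameters. -/
theorem eulerMat_trace (hn : 3 ≤ n) (l12 l13 l23 : ℝ) (a b : ℕ → ℕ → ℝ) :
    ((tangentVec n b * origin n)ᵀ * eulerMat hn l12 l13 l23 (tangentVec n a)).trace
      = (l23 - l13) * b 1 2 * ∑ k ∈ Finset.Icc 3 n, a 1 k * a 2 k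
        + ∑ k ∈ Finset.Icc 3 n, ((l12 - l23) * (b 1 k * (a 1 2 * a 2 k))
          + (l13 - l12) * (b 2 k * (a 1 2 * a 1 k))) := by
  set S := ∑ k ∈ Finset.Icc 3 n, a 1 k * a 2 k with hS
  -- The b₁₂ term is distributed over the first two rows, so that the identity can be checked row by
  -- row.
  have e : (l23 - l13) * b 1 2 * S = (∑ i : Fin n, if i = i0 hn then l23 * b 1 2 * S else 0)
      + ∑ i : Fin n, if i = i1 hn then -(l13 * b 1 2 * S) else 0 := by
    rw [Finset.sum_ite_eq' Finset.univ, Finset.sum_ite_eq' Finset.univ, if_pos (Finset.mem_univ _),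
      if_pos (Finset.mem_univ _)]
    ring
  rw [trace_transpose_mul, e, ← sum_Icc_three, ← Finset.sum_add_distrib, ← Finset.sum_add_distrib]
  refine Finset.sum_congr rfl fun i _ => ?_
  rw [mul_origin_apply_zero hn, mul_origin_apply_one hn]
  simp only [eulerMat, of_apply, if_true, one_ne_zero, if_false]
  have h01 : i0 hn ≠ i1 hn := by simp [i0, i1]
  rcases lt_or_ge i.val 2 with hi | hi
  · rw [if_pos hi]
    by_cases h : i.val = 0
    · obtain rfl : i = i0 hn := Fin.ext h
      rw [if_pos rfl, if_neg h01, tangentVec_sq_zero_one]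
      simp only [tangentVec_zero_apply]
      simp [i0, i1, ← hS]
      ring
    · obtain rfl : i = i1 hn := Fin.ext (show i.val = 1 by omega)
      rw [if_pos rfl, if_neg h01.symm, tangentVec_sq_one_zero]
      simp only [tangentVec_one_apply]
      simp [i0, i1, ← hS]
      ring
  · have n0 : i ≠ i0 hn := by rintro rfl; simp [i0] at hi
    have n1 : i ≠ i1 hn := by rintro rfl; simp [i1] at hi
    rw [if_neg n0, if_neg n1, if_neg (by omega), tangentVec_sq_apply_zero hn a hi,
      tangentVec_sq_apply_one hn a hi]
    simp only [tangentVec_apply_of_two_le _ hi, tangentVec_one_apply]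
    simp [i0, i1]
    ring

theorem isEquigeodesicVector_tangentVec_iff (hn : 3 ≤ n) (a : ℕ → ℕ → ℝ)
    (ha : tangentVec n a ≠ 0) :
    IsEquigeodesicVector n (tangentVec n a) ↔
      (∀ k ∈ Finset.Icc 3 n, a 1 2 * a 1 k = 0 ∧ a 1 2 * a 2 k = 0) ∧
        ∑ k ∈ Finset.Icc 3 n, a 1 k * a 2 k = 0 := by
  have hX : (tangentVec n a)ᵀ = -tangentVec n a :=
    (LieAlgebra.Orthogonal.mem_so _ _ _).1 (tangentVec_mem_TangentAlg hn a).1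
  constructor
  · rintro ⟨-, -, h⟩
    -- Any pairwise distinct positive parameters would do.
    have hop := diagMetric_hasOperator hn (l12 := 1) (l13 := 2) (l23 := 3) one_pos two_pos three_pos
    have hcrit := (energy_criterion hn hop hX).1 (h _ ⟨1, 2, 3, one_pos, two_pos, three_pos, hop⟩)
    have key : ∀ b : ℕ → ℕ → ℝ, _ := fun b =>
      (eulerMat_trace hn 1 2 3 a b).symm.trans (hcrit _ (tangentVec_mem_TangentAlg hn b))
    refine ⟨fun k hk => ⟨?_, ?_⟩, ?_⟩
    · have := key fun p q => if p = 2 ∧ q = k then 1 else 0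
      simp only [OfNat.one_ne_ofNat, false_and, if_false, true_and, ite_mul, zero_mul, mul_zero,
        mul_ite, one_mul, zero_add, Finset.sum_ite_eq', if_pos hk] at this
      linarith
    · have := key fun p q => if p = 1 ∧ q = k then 1 else 0
      have h2 : 2 ≠ k := fun h => by simp [← h] at hk
      simp only [OfNat.ofNat_ne_one, false_and, if_false, true_and, ite_mul, zero_mul, mul_zero,
        mul_ite, one_mul, zero_add, add_zero, Finset.sum_ite_eq', if_pos hk, if_neg h2] at this
      linarith
    · have := key fun p q => if p = 1 ∧ q = 2 then 1 else 0
      have e : ∀ k ∈ Finset.Icc 3 n, k ≠ 2 := fun k hk h => by simp [h] at hk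
      rw [add_eq_left.2 (Finset.sum_eq_zero fun k hk => by
        simp [e k hk])] at this
      simp only [and_self, if_true] at this
      linarith
  · rintro ⟨h1, h2⟩
    refine ⟨tangentVec_mem_TangentAlg hn a, ha, ?_⟩
    rintro g ⟨l12, l13, l23, -, -, -, hop⟩
    refine (energy_criterion hn hop hX).2 fun Y hY => ?_
    obtain ⟨b, rfl⟩ := (mem_TangentAlg_iff hn Y).1 hY
    rw [eulerMat_trace, h2, mul_zero, zero_add]
    refine Finset.sum_eq_zero fun k hk => ?_
    rw [(h1 k hk).1, (h1 k hk).2]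
    ring

end Stiefel

namespace Stiefel

variable {n : ℕ}

/-! ### The classes in coordinates -/

theorem mem_span_exists_iff {E : Type*} [AddCommGroup E] [Module ℝ E] (s : Finset ℕ) (f : ℕ → E)
    (x : E) : x ∈ Submodule.span ℝ {y | ∃ k ∈ s, y = f k} ↔
      ∃ c : ℕ → ℝ, x = ∑ k ∈ s, c k • f k := by
  constructor
  · intro hx
    induction hx using Submodule.span_induction with
    | mem y hy =>
      obtain ⟨k, hk, rfl⟩ := hy
      exact ⟨fun j => if j = k then 1 else 0, by simp [hk]⟩
    | zero => exact ⟨0, by simp⟩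
    | add y z _ _ hy hz =>
      obtain ⟨c, rfl⟩ := hy
      obtain ⟨d, rfl⟩ := hz
      exact ⟨c + d, by simp [add_smul, Finset.sum_add_distrib]⟩
    | smul r y _ hy =>
      obtain ⟨c, rfl⟩ := hy
      exact ⟨r • c, by simp [Finset.smul_sum, mul_smul]⟩
  · rintro ⟨c, rfl⟩
    exact Submodule.sum_mem _ fun k hk => Submodule.smul_mem _ _ (Submodule.subset_span ⟨k, hk, rfl⟩)

theorem sum_Icc_split {E : Type*} [AddCommMonoid E] (f : ℕ → E) {k : ℕ} (h3 : 3 ≤ k)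
    (hk : k ≤ n) : ∑ j ∈ Finset.Icc 3 n, f j
      = ∑ j ∈ Finset.Ico 3 k, f j + f k + ∑ j ∈ Finset.Icc (k + 1) n, f j := by
  rw [← Finset.sum_Ico_succ_top h3]
  exact (Finset.sum_Ico_consecutive f (by omega : 3 ≤ k + 1) (by omega : k + 1 ≤ n + 1)).symm

/-- Each class is turned into conditions on coordinates, so that classes can be compared through
`tangentVec_inj`. -/
theorem mem_class_one_iff (X : Matrix (Fin n) (Fin n) ℝ) :
    X ∈ vectorClass n 1 ↔ ∃ b, X = tangentVec n b ∧
      ∀ j ∈ Finset.Icc 3 n, b 1 j = 0 ∧ b 2 j = 0 := by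
  refine Submodule.mem_span_singleton.trans ⟨?_, ?_⟩
  · rintro ⟨c, rfl⟩
    refine ⟨fun p q => if q = 2 then c else 0, ?_, fun j hj => ?_⟩
    · rw [tangentVec, Finset.sum_eq_zero, Finset.sum_eq_zero]
      · simp
      all_goals
        intro k hk
        rw [if_neg (by rintro rfl; simp at hk), zero_smul]
    · have : j ≠ 2 := by rintro rfl; simp at hj
      simp [this]
  · rintro ⟨b, rfl, hb⟩
    refine ⟨b 1 2, ?_⟩
    rw [tangentVec, Finset.sum_eq_zero fun k hk => by rw [(hb k hk).1, zero_smul],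
      Finset.sum_eq_zero fun k hk => by rw [(hb k hk).2, zero_smul], add_zero, add_zero]

theorem mem_class_two_iff (X : Matrix (Fin n) (Fin n) ℝ) :
    X ∈ vectorClass n 2 ↔ ∃ b, X = tangentVec n b ∧ b 1 2 = 0 ∧
      ∀ j ∈ Finset.Icc 3 n, b 1 j = 0 := by
  refine (mem_span_exists_iff _ _ X).trans ⟨?_, ?_⟩
  · rintro ⟨c, rfl⟩
    exact ⟨fun p q => if p = 1 then 0 else c q, by simp [tangentVec], by simp, by simp⟩
  · rintro ⟨b, rfl, h12, hb⟩
    refine ⟨b 2, ?_⟩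
    rw [tangentVec, h12, zero_smul, zero_add,
      Finset.sum_eq_zero fun k hk => by rw [hb k hk, zero_smul], zero_add]

theorem exists_of_mem_m13 {X : Matrix (Fin n) (Fin n) ℝ} (hX : X ∈ m13 n) :
    ∃ b, X = tangentVec n b ∧ ∀ j ∈ Finset.Icc 3 n, b 2 j = 0 := by
  obtain ⟨c, rfl⟩ := (mem_span_exists_iff _ _ X).1 hX
  -- The value at (1, 2) is cleared because it would multiply ξ₁₂.
  refine ⟨fun p q => if p = 1 ∧ q ≠ 2 then c q else 0, ?_, by simp⟩
  simp only [tangentVec]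
  simp only [ne_eq, not_true_eq_false, and_false, if_false, zero_smul, zero_add,
    OfNat.ofNat_ne_one, false_and, Finset.sum_const_zero, add_zero]
  refine Finset.sum_congr rfl fun k hk => ?_
  rw [if_pos ⟨trivial, by rintro rfl; simp at hk⟩]

theorem mem_class_three_iff (hn : 3 ≤ n) (X : Matrix (Fin n) (Fin n) ℝ) :
    X ∈ vectorClass n 3 ↔ ∃ b, X = tangentVec n b ∧ b 1 2 = 0 ∧ b 2 3 = 0 ∧
      ∀ j ∈ Finset.Icc 4 n, b 1 j = 0 := by
  have split : ∀ b, tangentVec n b = b 1 2 • xi n 1 2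
      + (b 1 3 • xi n 1 3 + ∑ j ∈ Finset.Icc 4 n, b 1 j • xi n 1 j)
      + (b 2 3 • xi n 2 3 + ∑ j ∈ Finset.Icc 4 n, b 2 j • xi n 2 j) := by
    intro b
    rw [tangentVec, sum_Icc_split _ le_rfl hn, sum_Icc_split _ le_rfl hn]
    simp
  constructor
  · rintro ⟨a, rfl⟩
    refine ⟨fun p q => if p = 1 then (if q = 3 then a 1 3 else 0) else if q = 3 then 0 else a 2 q,
      ?_, by simp, by simp, fun j hj => ?_⟩
    · rw [split]
      simp only [if_true, OfNat.ofNat_ne_one, if_false, zero_smul, zero_add,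
        show (2 : ℕ) ≠ 3 by norm_num]
      have h0 : ∑ j ∈ Finset.Icc 4 n, (if j = 3 then a 1 3 else 0) • xi n 1 j = 0 :=
        Finset.sum_eq_zero fun k hk => by rw [if_neg (by rintro rfl; simp at hk), zero_smul]
      rw [h0, add_zero]
      congr 1
      refine Finset.sum_congr rfl fun k hk => ?_
      rw [if_neg (by rintro rfl; simp at hk)]
    · have : j ≠ 3 := by rintro rfl; simp at hj
      simp [this]
  · rintro ⟨b, rfl, h12, h23, hb⟩
    refine ⟨b, ?_⟩
    rw [split, h12, h23, Finset.sum_eq_zero fun k hk => by rw [hb k hk, zero_smul]]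
    simp

/-- The quotient in the definition is the relation ∑ a₁ⱼa₂ⱼ = 0 solved for a₂ₖ: terms with j > k
vanish and a₁ₖ ≠ 0. -/
theorem mem_class_iff_of_four_le {k : ℕ} (hk : 4 ≤ k) (hkn : k ≤ n)
    (X : Matrix (Fin n) (Fin n) ℝ) :
    X ∈ vectorClass n k ↔ ∃ b, X = tangentVec n b ∧ b 1 2 = 0 ∧ b 1 k ≠ 0 ∧
      (∀ j ∈ Finset.Icc (k + 1) n, b 1 j = 0) ∧ ∑ j ∈ Finset.Icc 3 n, b 1 j * b 2 j = 0 := by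
  have hdef : X ∈ vectorClass n k ↔ ∃ a : ℕ → ℕ → ℝ, a 1 k ≠ 0 ∧
      X = ∑ j ∈ Finset.Icc 3 k, a 1 j • xi n 1 j
        + ∑ j ∈ Finset.Ico 3 k, a 2 j • xi n 2 j
        - ((∑ j ∈ Finset.Ico 3 k, a 1 j * a 2 j) / a 1 k) • xi n 2 k
        + ∑ j ∈ Finset.Icc (k + 1) n, a 2 j • xi n 2 j := by
    -- With k in the form l + 4, the definition reduces to its last branch.
    obtain ⟨l, rfl⟩ := Nat.exists_eq_add_of_le' hk
    rfl
  have split1 : ∀ c : ℕ → ℝ, (∀ j ∈ Finset.Icc (k + 1) n, c j = 0) →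
      ∑ j ∈ Finset.Icc 3 n, c j • xi n 1 j = ∑ j ∈ Finset.Icc 3 k, c j • xi n 1 j := by
    intro c hc
    refine (Finset.sum_subset (Finset.Icc_subset_Icc_right hkn) fun j hj hjk => ?_).symm
    rw [hc j, zero_smul]
    simp only [Finset.mem_Icc] at hj hjk ⊢
    omega
  rw [hdef]
  constructor
  · rintro ⟨a, ha, rfl⟩
    set S := ∑ j ∈ Finset.Ico 3 k, a 1 j * a 2 j with hS
    -- The class formula ignores some values of `a`; `b` replaces them by the actual coordinates of
    -- the vector.
    let b : ℕ → ℕ → ℝ := fun p q => if p = 1 then (if q ∈ Finset.Icc 3 k then a 1 q else 0)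
      else if q = k then -(S / a 1 k) else a 2 q
    have b1 : ∀ j ∈ Finset.Icc 3 k, b 1 j = a 1 j := fun j hj => by
      simp only [b, if_pos hj, if_true]
    have b1' : ∀ j, j ∉ Finset.Icc 3 k → b 1 j = 0 := fun j hj => by
      simp only [b, if_neg hj, if_true]
    have b2 : ∀ j, j ≠ k → b 2 j = a 2 j := fun j hj => by simp [b, hj]
    have b2k : b 2 k = -(S / a 1 k) := by simp [b]
    have b1k : b 1 k = a 1 k := b1 k (Finset.mem_Icc.2 ⟨by omega, le_rfl⟩)
    have b1top : ∀ j ∈ Finset.Icc (k + 1) n, b 1 j = 0 := fun j hj => b1' j (by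
      simp only [Finset.mem_Icc] at hj ⊢
      omega)
    have b12 : b 1 2 = 0 := b1' 2 (by simp)
    refine ⟨b, ?_, b12, by rwa [b1k], b1top, ?_⟩
    · rw [tangentVec, split1 _ b1top, sum_Icc_split (fun j => b 2 j • xi n 2 j) (by omega) hkn,
        b12, b2k, zero_smul, zero_add, neg_smul, ← sub_eq_add_neg, ← add_assoc, ← add_sub_assoc]
      congr 1
      · congr 1
        congr 1
        · exact Finset.sum_congr rfl fun j hj => by rw [b1 j hj]
        · exact Finset.sum_congr rfl fun j hj => by
            rw [b2 j (by rintro rfl; simp at hj)]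
      · exact Finset.sum_congr rfl fun j hj => by
          rw [b2 j (by rintro rfl; simp at hj)]
    · rw [sum_Icc_split _ (by omega : 3 ≤ k) hkn, Finset.sum_eq_zero (s := Finset.Icc (k + 1) n)
        fun j hj => by rw [b1top j hj, zero_mul], b1k, b2k, add_zero]
      have : ∑ j ∈ Finset.Ico 3 k, b 1 j * b 2 j = S :=
        Finset.sum_congr rfl fun j hj => by
          rw [b2 j (by rintro rfl; simp at hj), b1 j (Finset.Ico_subset_Icc_self hj)]
      rw [this]
      field_simp
      ring
  · rintro ⟨b, rfl, h12, hk0, htop, hsum⟩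
    refine ⟨b, hk0, ?_⟩
    rw [sum_Icc_split _ (by omega : 3 ≤ k) hkn, Finset.sum_eq_zero (s := Finset.Icc (k + 1) n)
        fun j hj => by rw [htop j hj, zero_mul], add_zero] at hsum
    have h2k : b 2 k = -((∑ j ∈ Finset.Ico 3 k, b 1 j * b 2 j) / b 1 k) := by
      field_simp
      linarith
    rw [tangentVec, split1 _ htop, sum_Icc_split (fun j => b 2 j • xi n 2 j) (by omega) hkn,
        h12, h2k, zero_smul, zero_add, neg_smul, ← sub_eq_add_neg, ← add_assoc, ← add_sub_assoc]

/-! ### Solutions of the system and the classes -/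

/-- The algebraic system of equigeodesic vectors. -/
def EquigeodesicSystem (n : ℕ) (a : ℕ → ℕ → ℝ) : Prop :=
  (∀ k ∈ Finset.Icc 3 n, a 1 2 * a 1 k = 0 ∧ a 1 2 * a 2 k = 0) ∧
    ∑ k ∈ Finset.Icc 3 n, a 1 k * a 2 k = 0

theorem exists_mem_class_of_system (hn : 3 ≤ n) {a : ℕ → ℕ → ℝ} (h : EquigeodesicSystem n a) :
    ∃ k ∈ Finset.Icc 1 n, tangentVec n a ∈ vectorClass n k := by
  obtain ⟨h1, h2⟩ := h
  by_cases h12 : a 1 2 = 0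
  · by_cases hz : ∀ j ∈ Finset.Icc 3 n, a 1 j = 0
    · exact ⟨2, Finset.mem_Icc.2 ⟨by omega, by omega⟩, (mem_class_two_iff _).2 ⟨a, rfl, h12, hz⟩⟩
    · push Not at hz
      obtain ⟨j, hj, hj0⟩ := hz
      have hne : ((Finset.Icc 3 n).filter fun j => a 1 j ≠ 0).Nonempty :=
        ⟨j, Finset.mem_filter.2 ⟨hj, hj0⟩⟩
      -- The class is determined by the largest label k with a₁ₖ ≠ 0.
      obtain ⟨hk, hk0⟩ := Finset.mem_filter.1 (Finset.max'_mem _ hne)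
      have hmax := Finset.le_max' ((Finset.Icc 3 n).filter fun j => a 1 j ≠ 0)
      set k := ((Finset.Icc 3 n).filter fun j => a 1 j ≠ 0).max' hne
      obtain ⟨hk3, hkn⟩ := Finset.mem_Icc.1 hk
      have htop : ∀ j ∈ Finset.Icc (k + 1) n, a 1 j = 0 := by
        intro j hj
        by_contra hj0
        rw [Finset.mem_Icc] at hj
        have := hmax j (Finset.mem_filter.2 ⟨Finset.mem_Icc.2 ⟨by omega, hj.2⟩, hj0⟩)
        omega
      refine ⟨k, Finset.mem_Icc.2 ⟨by omega, hkn⟩, ?_⟩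
      rcases hk3.eq_or_lt with h3 | h4
      · rw [← h3] at htop hk0 ⊢
        refine (mem_class_three_iff hn _).2 ⟨a, rfl, h12, ?_, htop⟩
        -- For k = 3 the sum is just a₁₃a₂₃, so a₂₃ = 0.
        rw [sum_Icc_split _ le_rfl hn, Finset.sum_eq_zero (s := Finset.Icc (3 + 1) n)
          fun j hj => by rw [htop j hj, zero_mul]] at h2
        simpa [hk0] using h2
      · exact (mem_class_iff_of_four_le h4 hkn _).2 ⟨a, rfl, h12, hk0, htop, h2⟩
  · exact ⟨1, Finset.mem_Icc.2 ⟨le_rfl, by omega⟩, (mem_class_one_iff _).2 ⟨a, rfl, fun k hk =>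
      ⟨(mul_eq_zero.1 (h1 k hk).1).resolve_left h12,
        (mul_eq_zero.1 (h1 k hk).2).resolve_left h12⟩⟩⟩

theorem system_of_mem_class (hn : 3 ≤ n) {k : ℕ} (hk : k ∈ Finset.Icc 1 n)
    {X : Matrix (Fin n) (Fin n) ℝ} (hX : X ∈ vectorClass n k) :
    ∃ a, X = tangentVec n a ∧ EquigeodesicSystem n a := by
  obtain ⟨hk1, hkn⟩ := Finset.mem_Icc.1 hk
  obtain rfl | rfl | rfl | h4 : k = 1 ∨ k = 2 ∨ k = 3 ∨ 4 ≤ k := by omega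
  · obtain ⟨b, rfl, hb⟩ := (mem_class_one_iff _).1 hX
    exact ⟨b, rfl, fun k hk => by simp [hb k hk],
      Finset.sum_eq_zero fun k hk => by simp [hb k hk]⟩
  · obtain ⟨b, rfl, h12, hb⟩ := (mem_class_two_iff _).1 hX
    exact ⟨b, rfl, fun k hk => by simp [h12],
      Finset.sum_eq_zero fun k hk => by simp [hb k hk]⟩
  · obtain ⟨b, rfl, h12, h23, hb⟩ := (mem_class_three_iff hn _).1 hX
    refine ⟨b, rfl, fun k hk => by simp [h12], Finset.sum_eq_zero fun k hk => ?_⟩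
    obtain ⟨hk3, hkn⟩ := Finset.mem_Icc.1 hk
    rcases hk3.eq_or_lt with rfl | h4
    · rw [h23, mul_zero]
    · rw [hb k (Finset.mem_Icc.2 ⟨h4, hkn⟩), zero_mul]
  · obtain ⟨b, rfl, h12, -, -, hs⟩ := (mem_class_iff_of_four_le h4 hkn _).1 hX
    exact ⟨b, rfl, fun k hk => by simp [h12], hs⟩

/-! ### Separating vectors and nontrivial vectors -/

theorem tangentVec_eq_zero_iff (hn : 3 ≤ n) {a : ℕ → ℕ → ℝ} :
    tangentVec n a = 0 ↔ a 1 2 = 0 ∧ ∀ k ∈ Finset.Icc 3 n, a 1 k = 0 ∧ a 2 k = 0 := by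
  have : tangentVec n (fun _ _ => 0) = 0 := by simp [tangentVec]
  rw [← this, tangentVec_inj hn]

/-- The coordinates with a single `1` at the label `(p, q)`. -/
def unitCoords (p q : ℕ) (r s : ℕ) : ℝ := if r = p ∧ s = q then 1 else 0

/-- The witnesses are ξ₁₂, ξ₂₃ and, for k ≥ 3, ξ₁ₖ. Class 3 omits ξ₂₃ and all ξ₁ⱼ with j ≥ 4, and a
class j ≥ 4 demands a nonzero ξ₁ⱼ coefficient. -/
theorem exists_mem_class_not_mem_others (hn : 3 ≤ n) {k : ℕ} (hk : k ∈ Finset.Icc 1 n) :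
    ∃ X ∈ vectorClass n k, X ≠ 0 ∧ ∀ j ∈ Finset.Icc 1 n, j ≠ k → X ∉ vectorClass n j := by
  obtain ⟨hk1, hkn⟩ := Finset.mem_Icc.1 hk
  have h3 : 3 ∈ Finset.Icc 3 n := Finset.mem_Icc.2 ⟨le_rfl, hn⟩
  have ne2 : ∀ j ∈ Finset.Icc 3 n, j ≠ 2 := fun j hj h => by simp [h] at hj
  have cases4 : ∀ j ∈ Finset.Icc 1 n, j = 1 ∨ j = 2 ∨ j = 3 ∨ 4 ≤ j ∧ j ≤ n := fun j hj => by
    rw [Finset.mem_Icc] at hj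
    omega
  obtain rfl | rfl | h3k : k = 1 ∨ k = 2 ∨ 3 ≤ k := by omega
  · refine ⟨tangentVec n (unitCoords 1 2), (mem_class_one_iff _).2 ⟨_, rfl, fun j hj => ?_⟩, ?_, ?_⟩
    · simp [unitCoords, ne2 j hj]
    · rw [Ne, tangentVec_eq_zero_iff hn]
      simp [unitCoords]
    · intro j hj hj1 hmem
      obtain rfl | rfl | rfl | ⟨h4, hjn⟩ := cases4 j hj
      · exact hj1 rfl
      · obtain ⟨b, e, h12, -⟩ := (mem_class_two_iff _).1 hmem
        have := ((tangentVec_inj hn).1 e).1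
        simp [h12, unitCoords] at this
      · obtain ⟨b, e, h12, -⟩ := (mem_class_three_iff hn _).1 hmem
        have := ((tangentVec_inj hn).1 e).1
        simp [h12, unitCoords] at this
      · obtain ⟨b, e, h12, -⟩ := (mem_class_iff_of_four_le h4 hjn _).1 hmem
        have := ((tangentVec_inj hn).1 e).1
        simp [h12, unitCoords] at this
  · refine ⟨tangentVec n (unitCoords 2 3), (mem_class_two_iff _).2
      ⟨_, rfl, by simp [unitCoords], fun j hj => by simp [unitCoords]⟩, ?_, ?_⟩
    · rw [Ne, tangentVec_eq_zero_iff hn]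
      intro h
      simpa [unitCoords] using (h.2 3 h3).2
    · intro j hj hj1 hmem
      obtain rfl | rfl | rfl | ⟨h4, hjn⟩ := cases4 j hj
      · obtain ⟨b, e, hb⟩ := (mem_class_one_iff _).1 hmem
        have := (((tangentVec_inj hn).1 e).2 3 h3).2
        simp [hb 3 h3, unitCoords] at this
      · exact hj1 rfl
      · obtain ⟨b, e, -, h23, -⟩ := (mem_class_three_iff hn _).1 hmem
        have := (((tangentVec_inj hn).1 e).2 3 h3).2
        simp [h23, unitCoords] at this
      · obtain ⟨b, e, -, h1j, -⟩ := (mem_class_iff_of_four_le h4 hjn _).1 hmem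
        have := (((tangentVec_inj hn).1 e).2 j (Finset.mem_Icc.2 ⟨by omega, hjn⟩)).1
        exact h1j (this.symm.trans (by simp [unitCoords]))
  · have hkm : k ∈ Finset.Icc 3 n := Finset.mem_Icc.2 ⟨h3k, hkn⟩
    have u1 : ∀ j, j ≠ k → unitCoords 1 k 1 j = 0 := fun j hj => by simp [unitCoords, hj]
    have uk : unitCoords 1 k 1 k = 1 := by simp [unitCoords]
    have u2 : ∀ j, unitCoords 1 k 2 j = 0 := fun j => by simp [unitCoords]
    refine ⟨tangentVec n (unitCoords 1 k), ?_, ?_, ?_⟩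
    · rcases h3k.eq_or_lt with rfl | h4
      · exact (mem_class_three_iff hn _).2 ⟨_, rfl, u1 2 (by omega), u2 3, fun j hj => u1 j (by
          rw [Finset.mem_Icc] at hj; omega)⟩
      · refine (mem_class_iff_of_four_le h4 hkn _).2 ⟨_, rfl, u1 2 (by omega), by simp [uk],
          fun j hj => u1 j (by rw [Finset.mem_Icc] at hj; omega), ?_⟩
        simp [u2]
    · rw [Ne, tangentVec_eq_zero_iff hn]
      intro h
      simpa [uk] using (h.2 k hkm).1
    · intro j hj hj1 hmem
      obtain rfl | rfl | rfl | ⟨h4, hjn⟩ := cases4 j hj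
      · obtain ⟨b, e, hb⟩ := (mem_class_one_iff _).1 hmem
        have := (((tangentVec_inj hn).1 e).2 k hkm).1
        simp [hb k hkm, uk] at this
      · obtain ⟨b, e, -, hb⟩ := (mem_class_two_iff _).1 hmem
        have := (((tangentVec_inj hn).1 e).2 k hkm).1
        simp [hb k hkm, uk] at this
      · obtain ⟨b, e, -, -, hb⟩ := (mem_class_three_iff hn _).1 hmem
        have := (((tangentVec_inj hn).1 e).2 k hkm).1
        simp [hb k (Finset.mem_Icc.2 ⟨by omega, hkn⟩), uk] at this
      · obtain ⟨b, e, -, h1j, -⟩ := (mem_class_iff_of_four_le h4 hjn _).1 hmem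
        have := (((tangentVec_inj hn).1 e).2 j (Finset.mem_Icc.2 ⟨by omega, hjn⟩)).1
        exact h1j (this.symm.trans (u1 j hj1))

/-- The witness is ξ₁ₖ + ξ₂ₗ with l ≠ k: it has components in both 𝔪₁₃ and 𝔪₂₃, and orthogonality is
automatic. Two distinct labels from 3 on require n ≥ 4. -/
theorem exists_nontrivial_mem_class (hn : 4 ≤ n) {k : ℕ} (hk : 3 ≤ k) (hkn : k ≤ n) :
    ∃ X ∈ vectorClass n k, ¬IsTrivialVector n X := by
  have hn3 : 3 ≤ n := by omega
  obtain ⟨l, hl, hlk, hl3⟩ : ∃ l ∈ Finset.Icc 3 n, l ≠ k ∧ (k = 3 ∨ l = 3) := by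
    rcases hk.eq_or_lt with rfl | h4
    · exact ⟨4, Finset.mem_Icc.2 ⟨by omega, hn⟩, by omega, Or.inl rfl⟩
    · exact ⟨3, Finset.mem_Icc.2 ⟨le_rfl, hn3⟩, by omega, Or.inr rfl⟩
  have hkm : k ∈ Finset.Icc 3 n := Finset.mem_Icc.2 ⟨hk, hkn⟩
  let a : ℕ → ℕ → ℝ := unitCoords 1 k + unitCoords 2 l
  have a1 : ∀ j, j ≠ k → a 1 j = 0 := fun j hj => by simp [a, unitCoords, hj]
  have a2 : ∀ j, j ≠ l → a 2 j = 0 := fun j hj => by simp [a, unitCoords, hj]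
  have a1k : a 1 k = 1 := by simp [a, unitCoords]
  have a2l : a 2 l = 1 := by simp [a, unitCoords]
  refine ⟨tangentVec n a, ?_, ?_⟩
  · rcases hk.eq_or_lt with rfl | h4
    · exact (mem_class_three_iff hn3 _).2 ⟨a, rfl, a1 2 (by omega), a2 3 hlk.symm,
        fun j hj => a1 j (by rw [Finset.mem_Icc] at hj; omega)⟩
    · refine (mem_class_iff_of_four_le h4 hkn _).2 ⟨a, rfl, a1 2 (by omega), by simp [a1k],
        fun j hj => a1 j (by rw [Finset.mem_Icc] at hj; omega), Finset.sum_eq_zero fun j _ => ?_⟩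
      by_cases hj : j = k
      · rw [hj, a2 k hlk.symm, mul_zero]
      · rw [a1 j hj, zero_mul]
  · rintro (h | h | h)
    · obtain ⟨b, e, hb⟩ := (mem_class_one_iff _).1 h
      have := (((tangentVec_inj hn3).1 e).2 k hkm).1
      simp [hb k hkm, a1k] at this
    · obtain ⟨b, e, hb⟩ := exists_of_mem_m13 h
      have := (((tangentVec_inj hn3).1 e).2 l hl).2
      simp [hb l hl, a2l] at this
    · obtain ⟨b, e, -, hb⟩ := (mem_class_two_iff _).1 h
      have := (((tangentVec_inj hn3).1 e).2 k hkm).1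
      simp [hb k hkm, a1k] at this

end Stiefel

theorem mainTheorem4 (n : ℕ) (hn : 3 ≤ n) :
    -- the vectors of `𝔪` are the combinations of the `ξ₁ₖ` and `ξ₂ₖ`
    (∀ X, X ∈ Stiefel.TangentAlg n ↔ ∃ a : ℕ → ℕ → ℝ, X = Stiefel.tangentVec n a) ∧
    -- the algebraic system that characterizes equigeodesic vectors
    (∀ a : ℕ → ℕ → ℝ, Stiefel.tangentVec n a ≠ 0 →
      (Stiefel.IsEquigeodesicVector n (Stiefel.tangentVec n a) ↔
        (∀ k ∈ Finset.Icc 3 n, a 1 2 * a 1 k = 0 ∧ a 1 2 * a 2 k = 0) ∧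
          ∑ k ∈ Finset.Icc 3 n, a 1 k * a 2 k = 0)) ∧
    -- the equigeodesic vectors are the nonzero elements of the `n` classes
    {X | Stiefel.IsEquigeodesicVector n X}
      = (⋃ k ∈ Finset.Icc 1 n, Stiefel.vectorClass n k) \ {0} ∧
    -- none of the `n` classes is covered by the others
    (∀ k ∈ Finset.Icc 1 n, ∃ X ∈ Stiefel.vectorClass n k, X ≠ 0 ∧
      ∀ j ∈ Finset.Icc 1 n, j ≠ k → X ∉ Stiefel.vectorClass n j) ∧
    -- two classes are trivial, namely `𝔪₁₂` and `𝔪₂₃`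
    Stiefel.vectorClass n 1 = Stiefel.m12 n ∧
    Stiefel.vectorClass n 2 = Stiefel.m23 n ∧
    -- and, from `n = 4` on, these are the only ones that consist of trivial vectors
    (4 ≤ n → ∀ k ∈ Finset.Icc 1 n,
      ((∀ X ∈ Stiefel.vectorClass n k, Stiefel.IsTrivialVector n X) ↔ k = 1 ∨ k = 2)) := by
  refine ⟨Stiefel.mem_TangentAlg_iff hn, Stiefel.isEquigeodesicVector_tangentVec_iff hn, ?_,
    fun k hk => Stiefel.exists_mem_class_not_mem_others hn hk, rfl, rfl, fun h4 k hk => ⟨?_, ?_⟩⟩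
  · ext X
    simp only [Set.mem_ofPred_eq, Set.mem_sdiff, Set.mem_iUnion, Set.mem_singleton_iff, exists_prop]
    constructor
    · intro hX
      obtain ⟨a, rfl⟩ := (Stiefel.mem_TangentAlg_iff hn X).1 hX.1
      exact ⟨Stiefel.exists_mem_class_of_system hn
        ((Stiefel.isEquigeodesicVector_tangentVec_iff hn a hX.2.1).1 hX), hX.2.1⟩
    · rintro ⟨⟨k, hk, hX⟩, h0⟩
      obtain ⟨a, rfl, ha⟩ := Stiefel.system_of_mem_class hn hk hX
      exact (Stiefel.isEquigeodesicVector_tangentVec_iff hn a h0).2 ha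
  · intro h
    rw [Finset.mem_Icc] at hk
    by_contra hne
    obtain ⟨X, hX, hnt⟩ := Stiefel.exists_nontrivial_mem_class h4 (by omega : 3 ≤ k) hk.2
    exact hnt (h X hX)
  · rintro (rfl | rfl) X hX
    · exact Or.inl hX
    · exact Or.inr (Or.inr hX)
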